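/- Let $\mathbb F_q$ be a finite field with $q$ elements, of characteristic $p$, let $k=\mathbb F_q(\theta)$, $k_\infty=\mathbb F_q((1/\theta))$, let $\mathbb C_\infty$ be the completion of an algebraic closure of $k_\infty$, with the valuation $v_\infty$ normalized by $v_\infty(\theta)=-1$, and let $\overline k$ and $\overline{\mathbb F_q}$ be the algebraic closures of $k$ and $\mathbb F_q$ in $\mathbb C_\infty$. Fix $\tilde\theta\in\mathbb C_\infty$ with $\tilde\theta^{\,q-1}=-\theta$. Let $n\ge 0$, let $u_1,\dots,u_n\in\overline k$ satisfy $v_\infty(u_i)>-\frac{q}{q-1}$, put $K=k(\tilde\theta,u_1,\dots,u_n)$, and let $u\in K$ be a uniformizer of the discrete valuation ring $\{x\in K: v_\infty(x)\ge 0\}$. Let $d\ge1$ and let $\mathbf l,\mathbf l_1,\dots,\mathbf l_n\in\mathbb F_{q^d}[[Z]]$ be the power series with $$\mathbf l(u)=\frac1\theta,\qquad \mathbf l_i(u)=\frac{u_i}{\theta\tilde\theta}\quad(1\le i\le n)$$ (they exist, and are unique, when $\mathbb F_{q^d}$ is the residue field of the completion $K_\infty=k_\infty K$ of $K$). Let $\beta\in\overline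 k\setminus\{0\}$, let $s\ge1$ be an integer, and define the formal power series $$\pi_m(Z)=\beta^{-m}\prod_{i=1}^{m}\bigl(1-\theta\,\mathbf l(Z)^{q^i}\bigr)^s,\qquad G_0(Z)=\prod_{m\ge1}\bigl(1-\theta\,\mathbf l(Z)^{q^m}\bigr)^{-s},\qquad G_i(Z)=\sum_{m\ge0}\frac{\mathbf l_i(Z)^{q^m}}{\pi_m(Z)}\quad(1\le i\le n).$$ Let $\mathbf B=\bigcup_{h\ge0}\overline{\mathbb F_q}(\theta^{1/p^h},\beta^{1/p^h})$ be the purely inseparable closure of $\overline{\mathbb F_q}(\theta,\beta)$ in $\mathbb C_\infty$. If the family $(G_i(Z))_{i=0}^n$ is algebraically dependent over $k(Z)$, then there exist $\eta_0,\dots,\eta_n\in\mathbf B$, not all zero, such that $\sum_{i=0}^n\eta_iG_i(Z)$ is algebraic over $k(Z)$. -/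

import Mathlib

open scoped NNReal LaurentSeries PowerSeries WithZero

noncomputable section

namespace CarlitzMahler

/-! ### The fields `k_∞`, `ℂ_∞`, `k`, `k̄`, `𝐁`, `k(Z)` -/

section Infinity

variable (Fq : Type*) [Field Fq]

/-- `k_∞ = 𝔽_q((1/θ))`: Laurent series over `𝔽_q` in the variable `1/θ`. -/
def KInf : Type _ := Fq⸨X⸩

instance : Field (KInf Fq) := inferInstanceAs (Field Fq⸨X⸩)
instance : Algebra Fq (KInf Fq) := inferInstanceAs (Algebra Fq Fq⸨X⸩)
instance : Valued (KInf Fq) ℤᵐ⁰ := inferInstanceAs (Valued Fq⸨X⸩ ℤᵐ⁰)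
instance : CompleteSpace (KInf Fq) := inferInstanceAs (CompleteSpace Fq⸨X⸩)

/-- `1/θ`, the variable of the Laurent series field `k_∞`. -/
def invThetaInf : KInf Fq := (HahnSeries.single (1 : ℤ) (1 : Fq) : Fq⸨X⸩)

theorem valued_invThetaInf :
    (Valued.v : Valuation (KInf Fq) ℤᵐ⁰) (invThetaInf Fq) = WithZero.exp (-1 : ℤ) :=
  LaurentSeries.valuation_single_zpow Fq 1

end Infinity

section Fields

variable (Fq : Type*) [Field Fq] [Finite Fq]

/-- `q`, the cardinality of the finite field `𝔽_q`. -/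
abbrev q : ℕ := Nat.card Fq

theorem one_lt_q : (1 : ℝ≥0) < q Fq := by
  exact_mod_cast Finite.one_lt_card (α := Fq)

/-- The valuation of `k_∞` is turned into the absolute value `|x| = q ^ (-v_∞(x))`,
where `v_∞(1/θ) = 1`. -/
instance : (Valued.v : Valuation (KInf Fq) ℤᵐ⁰).RankOne where
  hom' := (WithZeroMulInt.toNNReal (one_pos.trans (one_lt_q Fq)).ne').comp
    MonoidWithZeroHom.ValueGroup₀.embedding
  strictMono' := (WithZeroMulInt.toNNReal_strictMono (one_lt_q Fq)).comp
    MonoidWithZeroHom.ValueGroup₀.embedding_strictMono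
  exists_val_nontrivial := ⟨invThetaInf Fq, by rw [valued_invThetaInf]; simp,
    by rw [valued_invThetaInf]; decide⟩

instance : NontriviallyNormedField (KInf Fq) := Valued.toNontriviallyNormedField (KInf Fq) ℤᵐ⁰

instance : IsUltrametricDist (KInf Fq) := inferInstance

/-- The algebraic closure of `k_∞` carries the unique extension of the absolute value
of `k_∞`. -/
instance : NontriviallyNormedField (AlgebraicClosure (KInf Fq)) :=
  spectralNorm.nontriviallyNormedField (KInf Fq) (AlgebraicClosure (KInf Fq))

instance : UniformContinuousConstSMul Fq (AlgebraicClosure (KInf Fq)) where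
  uniformContinuous_const_smul c := by
    simp only [Algebra.smul_def]
    exact uniformContinuous_const_smul
      (algebraMap Fq (AlgebraicClosure (KInf Fq)) c)

/-- `ℂ_∞`, the completion of an algebraic closure of `k_∞`. Its norm is `‖x‖ = q ^ (-v_∞(x))`. -/
abbrev CInf : Type _ := UniformSpace.Completion (AlgebraicClosure (KInf Fq))

/-- `θ` as an element of `ℂ_∞`. -/
def theta : CInf Fq :=
  ((algebraMap (KInf Fq) (AlgebraicClosure (KInf Fq)) (invThetaInf Fq)⁻¹ :
    AlgebraicClosure (KInf Fq)) : CInf Fq)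

/-- `k = 𝔽_q(θ)`, inside `ℂ_∞`. -/
abbrev k : IntermediateField Fq (CInf Fq) := IntermediateField.adjoin Fq {theta Fq}

/-- `k̄`, the algebraic closure of `k` in `ℂ_∞`. -/
abbrev kBar : IntermediateField (k Fq) (CInf Fq) := algebraicClosure (k Fq) (CInf Fq)

/-- The algebraic closure of `𝔽_q` in `ℂ_∞`. -/
abbrev FqBar : IntermediateField Fq (CInf Fq) := algebraicClosure Fq (CInf Fq)

/-- The field `𝔽̄_q(θ, β)`, inside `ℂ_∞`. -/
abbrev FqBarThetaBeta (β : CInf Fq) : IntermediateField (FqBar Fq) (CInf Fq) :=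
  IntermediateField.adjoin (FqBar Fq) {theta Fq, β}

/-- `𝐁`, the purely inseparable closure of `𝔽̄_q(θ, β)` in `ℂ_∞`, that is,
`⋃ₕ 𝔽̄_q(θ^(1/p^h), β^(1/p^h))`. -/
abbrev B (β : CInf Fq) : IntermediateField (FqBarThetaBeta Fq β) (CInf Fq) :=
  perfectClosure (FqBarThetaBeta Fq β) (CInf Fq)

/-- `k(Z)`, inside the field `ℂ_∞((Z))` of formal Laurent series. -/
abbrev kZ : IntermediateField (k Fq) (CInf Fq)⸨X⸩ :=
  IntermediateField.adjoin (k Fq) {HahnSeries.single (1 : ℤ) (1 : CInf Fq)}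

end Fields

/-! ### The interpolation series -/

section Series

variable {Fq : Type*} [Field Fq] [Finite Fq]

/-- `K = k(θ̃, u₁, …, uₙ)`. -/
abbrev K {n : ℕ} (θt : CInf Fq) (w : Fin n → CInf Fq) : IntermediateField (k Fq) (CInf Fq) :=
  IntermediateField.adjoin (k Fq) (insert θt (Set.range w))

/-- `u` is a uniformizer of the discrete valuation ring `{x ∈ L | v_∞(x) ≥ 0}`: it is a
nonzero element of its maximal ideal, of largest absolute value there. -/
def IsUniformizer (L : IntermediateField (k Fq) (CInf Fq)) (u : CInf Fq) : Prop :=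
  u ∈ L ∧ u ≠ 0 ∧ ‖u‖ < 1 ∧ ∀ x ∈ L, ‖x‖ < 1 → ‖x‖ ≤ ‖u‖

/-- `f ∈ 𝔽_{q^d}[[Z]]` and `f(u) = x`. Here `𝔽_{q^d}` is the subfield of `ℂ_∞` of the
solutions of `c ^ (q ^ d) = c`, and `f(u)` is the sum of a convergent series in `ℂ_∞`. -/
def IsExpansion (d : ℕ) (u : CInf Fq) (f : (CInf Fq)⟦X⟧) (x : CInf Fq) : Prop :=
  (∀ j, PowerSeries.coeff j f ^ (q Fq ^ d) = PowerSeries.coeff j f) ∧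
    HasSum (fun j : ℕ => PowerSeries.coeff j f * u ^ j) x

/-- `π_m(Z) = β^(-m) ∏_{i=1}^m (1 - θ 𝐥(Z)^(q^i))^s`. -/
def piSeries (l : (CInf Fq)⟦X⟧) (β : CInf Fq) (s m : ℕ) : (CInf Fq)⟦X⟧ :=
  PowerSeries.C (β⁻¹ ^ m) *
    ∏ i ∈ Finset.Icc 1 m, (1 - PowerSeries.C (theta Fq) * l ^ (q Fq ^ i)) ^ s

open scoped PowerSeries.WithPiTopology in
/-- `G₀(Z) = ∏_{m ≥ 1} (1 - θ 𝐥(Z)^(q^m))^(-s)`, a convergent product of formal power series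
when `𝐥(0) = 0`. -/
def GZero (l : (CInf Fq)⟦X⟧) (s : ℕ) : (CInf Fq)⟦X⟧ :=
  ∏' m : ℕ, ((1 - PowerSeries.C (theta Fq) * l ^ (q Fq ^ (m + 1)))⁻¹) ^ s

open scoped PowerSeries.WithPiTopology in
/-- `∑_{m ≥ 0} 𝐥ᵢ(Z)^(q^m) / π_m(Z)`, a convergent series of formal power series when
`𝐥(0) = 𝐥ᵢ(0) = 0`. -/
def GLog (l li : (CInf Fq)⟦X⟧) (β : CInf Fq) (s : ℕ) : (CInf Fq)⟦X⟧ :=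
  ∑' m : ℕ, li ^ (q Fq ^ m) * (piSeries l β s m)⁻¹

/-- The family `G₀, G₁, …, Gₙ`, in `ℂ_∞((Z))`. -/
def G {n : ℕ} (l : (CInf Fq)⟦X⟧) (li : Fin n → (CInf Fq)⟦X⟧) (β : CInf Fq) (s : ℕ) :
    Fin (n + 1) → (CInf Fq)⸨X⸩ :=
  Fin.cons (HahnSeries.ofPowerSeries ℤ (CInf Fq) (GZero l s)) fun i => HahnSeries.ofPowerSeries ℤ (CInf Fq) (GLog l (li i) β s)

end Series

end CarlitzMahler

end

/-!
The coefficients of `𝐥` and `𝐥ᵢ` are fixed by the `q^d`-power Frobenius, so `Z ↦ Z^N` with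
`N = q^d` raises these series to the power `N`. This gives the functional equations
`G₀(Z^N) = κ a G₀(Z)` and `Gᵢ(Z^N) = a Gᵢ(Z) + bᵢ`, in which `κ = β^d` is a constant and `a = π_d`
and `bᵢ` are algebraic over `k(Z)`: evaluation at `u` is injective on `𝔽_{q^d}[[Z]]`, and since `k̄`
has transcendence degree one over `𝔽_q`, the values of `𝐥` and `𝐥ᵢ` at `u` satisfy polynomial
relations with `u`, which lift to relations with `Z`.

The functional equations induce a semilinear substitution on polynomials in `G₀, …, Gₙ` that
preserves the ideal of algebraic relations. A relation of minimal leading monomial is an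
eigenvector, and so are its coefficients as a polynomial in `G₀` and their partial derivatives in
the other variables. If all partial derivatives of an eigenvector vanish, it is a polynomial in
`p`-th powers, and `p`-th roots can be taken at the end because `𝐁` is perfect. Hence some
eigenvector of positive degree has constant partial derivatives, not all zero, and then it has
degree one unless `G₀` is algebraic. The ratios of its linear coefficients are invariant under
`Z ↦ Z^N`; an invariant Laurent series is a constant, here an element of `𝐁`.
-/

namespace CarlitzMahler

/-! ### Semilinear affine substitutions in polynomials -/

section Monomials

variable {ι : Type*}

theorem exists_eq_add_single {α : ι →₀ ℕ} {i : ι} (h : α i ≠ 0) :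
    ∃ δ, α = δ + Finsupp.single i 1 :=
  ⟨α - Finsupp.single i 1, (tsub_add_cancel_of_le (by
    simpa using Nat.one_le_iff_ne_zero.2 h)).symm⟩

theorem add_single_induction {motive : (ι →₀ ℕ) → Prop} (zero : motive 0)
    (add_single : ∀ δ i, motive δ → motive (δ + Finsupp.single i 1)) (α : ι →₀ ℕ) : motive α := by
  induction hN : α.degree generalizing α with
  | zero => exact (Finsupp.degree_eq_zero_iff α).1 hN ▸ zero
  | succ N ih =>
    obtain ⟨i, hi⟩ : ∃ i, α i ≠ 0 := by
      by_contra! hα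
      simp [show α = 0 from Finsupp.ext hα] at hN
    obtain ⟨δ, rfl⟩ := exists_eq_add_single hi
    exact add_single δ i (ih δ (by simpa using hN))

theorem exists_eq_single_of_degree_eq_one {α : ι →₀ ℕ} (h : α.degree = 1) :
    ∃ i, α = Finsupp.single i 1 := by
  induction α using add_single_induction with
  | zero => simp at h
  | add_single δ i _ =>
    have hδ : δ.degree = 0 := by simpa using h
    exact ⟨i, by rw [(Finsupp.degree_eq_zero_iff δ).1 hδ, zero_add]⟩

theorem prod_pow_add_single {M : Type*} [CommMonoid M] (f : ι → M) (δ : ι →₀ ℕ) (i : ι) :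
    ((δ + Finsupp.single i 1).prod fun i e => f i ^ e) = (δ.prod fun i e => f i ^ e) * f i := by
  rw [Finsupp.prod_add_index' (by simp) (by intros; rw [pow_add])]
  simp

end Monomials

section Polynomials

open MvPolynomial

variable {ι R : Type*} [CommSemiring R]

theorem totalDegree_pderiv_lt (i : ι) {P : MvPolynomial ι R} (hP : P.totalDegree ≠ 0) :
    (pderiv i P).totalDegree < P.totalDegree := by
  rw [totalDegree, Finset.sup_lt_iff (Nat.pos_of_ne_zero hP)]
  intro α hα
  have hα' : α + Finsupp.single i 1 ∈ P.support := by
    rw [mem_support_iff] at hα ⊢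
    intro h0
    exact hα (by rw [coeff_pderiv, h0, zero_mul])
  have hle : (α + Finsupp.single i 1).degree ≤ P.totalDegree := le_totalDegree hα'
  rw [map_add, Finsupp.degree_single] at hle
  exact hle

theorem exists_expand_eq_of_pderiv_eq_zero [NoZeroDivisors R] (p : ℕ) [CharP R p]
    {P : MvPolynomial ι R} (hP : ∀ i, pderiv i P = 0) : ∃ T, expand p T = P := by
  suffices P ∈ (expand p : MvPolynomial ι R →ₐ[R] _).range from this
  rw [P.as_sum]
  refine Subalgebra.sum_mem _ fun α hα => ?_
  have hdvd (i : ι) : p ∣ α i := by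
    by_cases h0 : α i = 0
    · simp [h0]
    obtain ⟨δ, rfl⟩ := exists_eq_add_single h0
    have hcoeff := coeff_pderiv (i := i) P δ
    rw [hP i, coeff_zero, eq_comm, mul_eq_zero] at hcoeff
    rw [← CharP.cast_eq_zero_iff R p]
    simpa using hcoeff.resolve_left (mem_support_iff.1 hα)
  have hα' : p • α.mapRange (· / p) (Nat.zero_div p) = α := by
    ext i
    simpa using Nat.mul_div_cancel' (hdvd i)
  exact ⟨monomial (α.mapRange (· / p) (Nat.zero_div p)) (coeff α P),
    (expand_monomial p _ _).trans (by rw [hα'])⟩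

theorem eq_C_add_sum_C_mul_X [Fintype ι] {P : MvPolynomial ι R} (hP : P.totalDegree ≤ 1) :
    P = C (coeff 0 P) + ∑ i, C (coeff (Finsupp.single i 1) P) * X i := by
  classical
  ext α
  simp only [coeff_add, coeff_sum, coeff_C, coeff_C_mul, coeff_X]
  by_cases hα : α.degree ≤ 1
  · rcases Nat.le_one_iff_eq_zero_or_eq_one.1 hα with h0 | h1
    · obtain rfl := (Finsupp.degree_eq_zero_iff α).1 h0
      simp
    · obtain ⟨i, rfl⟩ := exists_eq_single_of_degree_eq_one h1
      simp [Finsupp.single_left_inj, eq_comm]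
  · rw [notMem_support_iff.1 fun hmem => hα ((le_totalDegree hmem).trans hP), if_neg, zero_add,
      Finset.sum_eq_zero]
    · rintro i -
      rw [if_neg, mul_zero]
      rintro rfl
      simp at hα
    · rintro rfl
      simp at hα

end Polynomials

section AffineSubst

open MvPolynomial
open scoped MonomialOrder

variable {ι R S : Type*} [CommSemiring R] [CommSemiring S]

/-- The `σ`-semilinear homomorphism `R[X] → S[X]` with `Xᵢ ↦ aᵢ Xᵢ + bᵢ`. Functions that satisfy
`σ (xᵢ) = aᵢ xᵢ + bᵢ` intertwine it with `σ`, see `aeval_affineSubst`. -/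
noncomputable def affineSubst (σ : R →+* S) (a b : ι → S) :
    MvPolynomial ι R →+* MvPolynomial ι S :=
  eval₂Hom (C.comp σ) fun i => C (a i) * X i + C (b i)

variable (σ : R →+* S) (a b : ι → S)

@[simp]
theorem affineSubst_C (c : R) : affineSubst σ a b (C c) = C (σ c) := by
  simp [affineSubst]

@[simp]
theorem affineSubst_X (i : ι) : affineSubst σ a b (X i) = C (a i) * X i + C (b i) := by
  simp [affineSubst]

theorem aeval_affineSubst {A B : Type*} [CommSemiring A] [CommSemiring B] [Algebra R A]
    [Algebra S B] {τ : A →+* B} (hτ : ∀ c, τ (algebraMap R A c) = algebraMap S B (σ c))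
    {x : ι → A} {y : ι → B}
    (hx : ∀ i, τ (x i) = algebraMap S B (a i) * y i + algebraMap S B (b i))
    (P : MvPolynomial ι R) : aeval y (affineSubst σ a b P) = τ (aeval x P) := by
  have hcomp : (aeval y : MvPolynomial ι S →ₐ[S] B).toRingHom.comp (affineSubst σ a b) =
      τ.comp (aeval x : MvPolynomial ι R →ₐ[R] A).toRingHom :=
    MvPolynomial.ringHom_ext (fun c => by simp [hτ]) fun i => by simp [hx]
  exact congrArg (fun f : MvPolynomial ι R →+* B => f P) hcomp

theorem pderiv_affineSubst (i : ι) (P : MvPolynomial ι R) :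
    pderiv i (affineSubst σ a b P) = C (a i) * affineSubst σ a b (pderiv i P) := by
  induction P using MvPolynomial.induction_on with
  | C c => simp
  | add P Q hP hQ => simp only [map_add, hP, hQ, mul_add]
  | mul_X P j h =>
    rw [map_mul, pderiv_mul, h, pderiv_mul, map_add, map_mul, map_mul, affineSubst_X]
    by_cases hij : j = i
    · subst hij
      simp only [map_add, pderiv_C_mul, pderiv_X_self, pderiv_C, map_one]
      ring
    · simp only [map_add, pderiv_C_mul, pderiv_X_of_ne hij, pderiv_C, map_zero]
      ring

theorem affineSubst_expand (p : ℕ) [ExpChar S p] (P : MvPolynomial ι R) :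
    affineSubst σ a b (expand p P) = expand p (affineSubst σ (a ^ p) (b ^ p) P) := by
  have hcomp : (affineSubst σ a b).comp (expand p : MvPolynomial ι R →ₐ[R] _).toRingHom =
      (expand p : MvPolynomial ι S →ₐ[S] _).toRingHom.comp (affineSubst σ (a ^ p) (b ^ p)) :=
    MvPolynomial.ringHom_ext (fun c => by simp) fun i => by simp [add_pow_expChar, mul_pow]
  exact congrArg (fun f : MvPolynomial ι R →+* _ => f P) hcomp

theorem coeff_finSuccEquiv_affineSubst {n : ℕ} (a₀ : S) (a b : Fin n → S)
    (P : MvPolynomial (Fin (n + 1)) R) (j : ℕ) :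
    (finSuccEquiv S n (affineSubst σ (Fin.cons a₀ a) (Fin.cons 0 b) P)).coeff j =
      affineSubst σ a b ((finSuccEquiv R n P).coeff j) * C a₀ ^ j := by
  have hcomp : ((finSuccEquiv S n).toRingEquiv.toRingHom).comp
      (affineSubst σ (Fin.cons a₀ a) (Fin.cons 0 b)) =
      ((Polynomial.compRingHom (Polynomial.C (C a₀) * Polynomial.X)).comp
        (Polynomial.mapRingHom (affineSubst σ a b))).comp
        ((finSuccEquiv R n).toRingEquiv.toRingHom) := by
    refine MvPolynomial.ringHom_ext (fun c => ?_) fun i => ?_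
    · simp [finSuccEquiv_apply]
    · refine Fin.cases ?_ (fun i => ?_) i <;> simp [finSuccEquiv_apply]
  have hP := congrArg (fun f : MvPolynomial (Fin (n + 1)) R →+* _ => (f P).coeff j) hcomp
  exact hP.trans (Polynomial.comp_C_mul_X_coeff.trans (by simp))

theorem affineSubst_monomial (α : ι →₀ ℕ) (c : R) :
    affineSubst σ a b (monomial α c) =
      C (σ c) * α.prod fun i e => (C (a i) * X i + C (b i)) ^ e :=
  eval₂Hom_monomial _ _ _ _

variable (m : MonomialOrder ι)

theorem degree_C_mul_X_add_C_le (i : ι) (c d : R) :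
    m.degree (C c * X i + C d) ≼[m] Finsupp.single i 1 := by
  refine m.degree_add_le.trans (sup_le ?_ (by simp))
  rw [← smul_eq_C_mul]
  exact m.degree_smul_le.trans m.degree_X_le_single

theorem degree_prod_affine_pow_le (α : ι →₀ ℕ) :
    m.degree (α.prod fun i e => (C (a i) * X i + C (b i)) ^ e) ≼[m] α := by
  induction α using add_single_induction with
  | zero => simp
  | add_single δ i ih =>
    rw [prod_pow_add_single, map_add]
    refine m.degree_mul_le.trans ?_
    rw [map_add]
    gcongr
    exact degree_C_mul_X_add_C_le m i (a i) (b i)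

theorem coeff_prod_affine_pow (m : MonomialOrder ι) (α : ι →₀ ℕ) :
    coeff α (α.prod fun i e => (C (a i) * X i + C (b i)) ^ e) = α.prod fun i e => a i ^ e := by
  classical
  induction α using add_single_induction with
  | zero => simp
  | add_single δ i ih =>
    rw [prod_pow_add_single, prod_pow_add_single,
      m.coeff_mul_of_add_of_degree_le (degree_prod_affine_pow_le a b m δ)
        (degree_C_mul_X_add_C_le m i (a i) (b i)), ih]
    simp [coeff_C, eq_comm (a := (0 : ι →₀ ℕ))]

theorem coeff_affineSubst {P : MvPolynomial ι R} {α : ι →₀ ℕ} (hα : m.degree P ≼[m] α) :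
    coeff α (affineSubst σ a b P) = σ (coeff α P) * α.prod fun i e => a i ^ e := by
  classical
  have hmonomial (β : ι →₀ ℕ) (hβ : β ∈ P.support) :
      coeff α (affineSubst σ a b (monomial β (coeff β P))) =
        if β = α then σ (coeff α P) * (α.prod fun i e => a i ^ e) else 0 := by
    rw [affineSubst_monomial, coeff_C_mul]
    split_ifs with hβα
    · rw [← hβα, coeff_prod_affine_pow a b m]
    · have hlt : β ≺[m] α :=
        ((m.le_degree hβ).trans hα).lt_of_ne (m.toSyn.injective.ne hβα)
      rw [m.coeff_eq_zero_of_lt ((degree_prod_affine_pow_le a b m β).trans_lt hlt), mul_zero]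
  conv_lhs => rw [P.as_sum, map_sum, coeff_sum, Finset.sum_congr rfl hmonomial, Finset.sum_ite_eq']
  rw [ite_eq_left_iff]
  intro hα'
  rw [notMem_support_iff.1 hα', map_zero, zero_mul]

theorem degree_affineSubst_le (P : MvPolynomial ι R) :
    m.degree (affineSubst σ a b P) ≼[m] m.degree P := by
  refine m.degree_le_iff.2 fun α hα => ?_
  by_contra! hlt
  refine mem_support_iff.1 hα ?_
  rw [coeff_affineSubst σ a b m hlt.le, m.coeff_eq_zero_of_lt hlt, map_zero, zero_mul]

end AffineSubst

section Eigenvectors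

open MvPolynomial
open scoped MonomialOrder

variable {ι E : Type*} [Field E] (σ : E →+* E) (a b : ι → E)

theorem exists_affineSubst_eq_C_mul (m : MonomialOrder ι) {I : Ideal (MvPolynomial ι E)}
    (hI : ∀ P ∈ I, affineSubst σ a b P ∈ I) (hne : I ≠ ⊥) :
    ∃ P ∈ I, P ≠ 0 ∧ ∃ μ, affineSubst σ a b P = C μ * P := by
  obtain ⟨P₀, hP₀, hP₀ne⟩ := Submodule.exists_mem_ne_zero_of_ne_bot hne
  obtain ⟨P, ⟨hPI, hP⟩, hmin⟩ := WellFounded.has_min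
    (InvImage.wf (fun P : MvPolynomial ι E => m.toSyn (m.degree P)) wellFounded_lt)
    {P | P ∈ I ∧ P ≠ 0} ⟨P₀, hP₀, hP₀ne⟩
  set α := m.degree P
  have hr : coeff α P ≠ 0 := m.coeff_degree_ne_zero_iff.2 hP
  set μ := coeff α (affineSubst σ a b P) / coeff α P
  refine ⟨P, hPI, hP, μ, ?_⟩
  by_contra hne
  -- The choice of `μ` cancels the leading term, against the minimality of the degree of `P`.
  have hRI : affineSubst σ a b P - C μ * P ∈ I := I.sub_mem (hI P hPI) (I.mul_mem_left _ hPI)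
  set R := affineSubst σ a b P - C μ * P with hR
  have hR0 : R ≠ 0 := sub_ne_zero.2 hne
  have hle : m.degree R ≼[m] α := by
    refine m.degree_sub_le.trans (sup_le (degree_affineSubst_le σ a b m P) ?_)
    rw [← smul_eq_C_mul]
    exact m.degree_smul_le
  have hα : coeff α R = 0 := by
    rw [hR, coeff_sub, coeff_C_mul, div_mul_cancel₀ _ hr, sub_self]
  have hne' : m.degree R ≠ α := by
    intro h
    exact m.coeff_degree_ne_zero_iff.2 hR0 (h ▸ hα)
  exact hmin R ⟨hRI, hR0⟩ (hle.lt_of_ne (m.toSyn.injective.ne hne'))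

variable {σ a b} {P : MvPolynomial ι E} {μ : E}

theorem affineSubst_pderiv_eq_C_mul {i : ι} (ha : a i ≠ 0) (hP : affineSubst σ a b P = C μ * P) :
    affineSubst σ a b (pderiv i P) = C (μ / a i) * pderiv i P := by
  refine mul_left_cancel₀ (a := C (a i)) (by simpa using ha) ?_
  rw [← pderiv_affineSubst, hP, pderiv_C_mul, ← mul_assoc, ← C_mul, mul_div_cancel₀ _ ha]

theorem affineSubst_eq_C_mul_of_expand (p : ℕ) [ExpChar E p]
    (hP : affineSubst σ a b (expand p P) = C μ * expand p P) :
    affineSubst σ (a ^ p) (b ^ p) P = C μ * P := by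
  refine expand_injective (expChar_pos E p) ?_
  rw [map_mul, expand_C, ← affineSubst_expand, hP]

theorem affineSubst_coeff_finSuccEquiv_eq_C_mul {n : ℕ} {a₀ : E} (ha₀ : a₀ ≠ 0) {a b : Fin n → E}
    {P : MvPolynomial (Fin (n + 1)) E}
    (hP : affineSubst σ (Fin.cons a₀ a) (Fin.cons 0 b) P = C μ * P) (j : ℕ) :
    affineSubst σ a b ((finSuccEquiv E n P).coeff j) =
      C (μ / a₀ ^ j) * (finSuccEquiv E n P).coeff j := by
  have hcoeff : (finSuccEquiv E n (C μ * P)).coeff j = C μ * (finSuccEquiv E n P).coeff j := by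
    rw [map_mul, finSuccEquiv_apply (p := C μ)]
    simp
  refine mul_right_cancel₀ (b := C a₀ ^ j) (pow_ne_zero j (by simpa using ha₀)) ?_
  rw [← coeff_finSuccEquiv_affineSubst, hP, hcoeff, mul_right_comm, ← C_pow, ← C_mul,
    div_mul_cancel₀ _ (pow_ne_zero j ha₀)]

theorem map_leadingCoeff_mul_pow_eq [LinearOrder ι] [WellFoundedGT ι] {a : E}
    (hP : affineSubst σ (fun _ => a) b P = C μ * P) :
    σ (MonomialOrder.degLex.leadingCoeff P) * a ^ P.totalDegree =
      μ * MonomialOrder.degLex.leadingCoeff P := by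
  have hcoeff := coeff_affineSubst σ (fun _ => a) b MonomialOrder.degLex (P := P) le_rfl
  rw [hP, coeff_C_mul, Finsupp.prod, Finset.prod_pow_eq_pow_sum] at hcoeff
  rw [← degree_degLexDegree]
  exact hcoeff.symm

end Eigenvectors

/-! ### Linear relations from algebraic relations over difference fields -/

section DifferenceFields

open MvPolynomial

theorem pderiv_eq_C {ι R : Type*} [CommSemiring R] {i : ι} {P : MvPolynomial ι R}
    (hP : (pderiv i P).totalDegree = 0) : pderiv i P = C (coeff (Finsupp.single i 1) P) := by
  rw [totalDegree_eq_zero_iff_eq_C.1 hP, coeff_pderiv]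
  simp

theorem map_coeff_single_eq {ι E : Type*} [Field E] {σ : E →+* E} {a b : ι → E} {μ : E} {i : ι}
    {P : MvPolynomial ι E} (ha : a i ≠ 0) (hP : affineSubst σ a b P = C μ * P)
    (hconst : (pderiv i P).totalDegree = 0) :
    σ (coeff (Finsupp.single i 1) P) = μ / a i * coeff (Finsupp.single i 1) P := by
  have hpderiv := affineSubst_pderiv_eq_C_mul ha hP
  rw [pderiv_eq_C hconst, affineSubst_C, ← C_mul] at hpderiv
  exact C_injective _ _ hpderiv

theorem isAlgebraic_of_finSuccEquiv_coeff_totalDegree_eq_zero {E A : Type*} [CommRing E]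
    [CommRing A] [Algebra E A] {n : ℕ} {P : MvPolynomial (Fin (n + 1)) E} {x : Fin (n + 1) → A}
    (hP : P ≠ 0) (hx : aeval x P = 0)
    (hcoeff : ∀ j, ((finSuccEquiv E n P).coeff j).totalDegree = 0) : IsAlgebraic E (x 0) := by
  obtain ⟨f, hf⟩ : ∃ f : Polynomial E, f.map C = finSuccEquiv E n P :=
    (Polynomial.mem_lifts _).1 <| (Polynomial.lifts_iff_coeff_lifts _).2 fun j =>
      ⟨_, (totalDegree_eq_zero_iff_eq_C.1 (hcoeff j)).symm⟩
  have hfP : Polynomial.aeval (X 0) f = P := by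
    apply (finSuccEquiv E n).injective
    rw [← hf, ← Polynomial.aeval_algHom_apply, finSuccEquiv_X_zero, Polynomial.aeval_def,
      Polynomial.map, Polynomial.eval₂_eq_eval_map, Polynomial.eval₂_eq_eval_map]
    rfl
  refine ⟨f, ?_, ?_⟩
  · rintro rfl
    exact hP (by simpa using hfP.symm)
  · rwa [← hfP, ← Polynomial.aeval_algHom_apply, aeval_X] at hx

/-- A field `Λ` with an endomorphism `σ`, extending the endomorphism `σE` of `E`, and a
perfect field `const` of constants that contains the eigenvectors of `σ` with eigenvalue in
`const`. The latter is only required of eigenvectors in a subfield `M`, which is not assumed to be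
stable under `σ`. -/
structure DifferenceExtension (E Λ : Type*) [Field E] [Field Λ] [Algebra E Λ] (p : ℕ) where
  σE : E →+* E
  σ : Λ →+* Λ
  M : Subfield Λ
  const : Subfield Λ
  map_algebraMap : ∀ x, σ (algebraMap E Λ x) = algebraMap E Λ (σE x)
  algebraMap_mem : ∀ x, algebraMap E Λ x ∈ M
  isAlgebraic : ∀ c ∈ const, IsAlgebraic E c
  const_of_eigenvector : ∀ κ ∈ const, ∀ g ∈ M, σ g = κ * g → g ∈ const
  perfect : ∀ c : const, ∃ γ : const, γ ^ p = c

namespace DifferenceExtension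

variable {E Λ : Type*} [Field E] [Field Λ] [Algebra E Λ] {p : ℕ}

/-- `G₀` and `Gᵢ` solve the triangular system `σ G₀ = κ a G₀`, `σ Gᵢ = a Gᵢ + bᵢ` with a
constant `κ`. -/
structure IsSolution (S : DifferenceExtension E Λ p) {ι : Type*} (κ : Λ) (a : E) (b : ι → E)
    (G₀ : Λ) (G : ι → Λ) : Prop where
  ratio_mem_const : κ ∈ S.const
  ne_zero : a ≠ 0
  zero_mem : G₀ ∈ S.M
  mem : ∀ i, G i ∈ S.M
  map_zero : S.σ G₀ = κ * algebraMap E Λ a * G₀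
  map : ∀ i, S.σ (G i) = algebraMap E Λ a * G i + algebraMap E Λ (b i)

/-- Modulo elements that are algebraic over `E`, the `Gᵢ` satisfy a nontrivial linear relation with
constant coefficients, up to a constant multiple of `G₀`. -/
def HasLinearRelation (S : DifferenceExtension E Λ p) {ι : Type*} [Fintype ι] (G₀ : Λ)
    (G : ι → Λ) : Prop :=
  ∃ (c₀ : S.const) (c : ι → S.const), c ≠ 0 ∧ IsAlgebraic E (c₀ * G₀ + ∑ i, c i * G i)

variable {S : DifferenceExtension E Λ p} {ι : Type*} {κ G₀ : Λ} {a : E} {b : ι → E} {G : ι → Λ}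

theorem IsSolution.div_pow_mem_const (h : S.IsSolution κ a b G₀ G) {y : Λ} {m : ℕ}
    (hy : y ∈ S.M) (hσy : S.σ y = algebraMap E Λ a ^ m * y) : y / G₀ ^ m ∈ S.const := by
  refine S.const_of_eigenvector (κ⁻¹ ^ m) (pow_mem (inv_mem h.ratio_mem_const) m) _
    (div_mem hy (pow_mem h.zero_mem m)) ?_
  have ha : algebraMap E Λ a ^ m ≠ 0 := pow_ne_zero m (by simpa using h.ne_zero)
  rw [map_div₀, map_pow, h.map_zero, hσy, mul_assoc, mul_left_comm, mul_pow,
    mul_div_mul_left _ _ ha, mul_pow, inv_pow, div_mul_eq_div_div_swap, div_eq_inv_mul]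

theorem IsSolution.pow [ExpChar E p] (h : S.IsSolution κ a b G₀ G) :
    S.IsSolution (κ ^ p) (a ^ p) (b ^ p) (G₀ ^ p) (G ^ p) where
  ratio_mem_const := pow_mem h.ratio_mem_const p
  ne_zero := pow_ne_zero p h.ne_zero
  zero_mem := pow_mem h.zero_mem p
  mem i := pow_mem (h.mem i) p
  map_zero := by rw [map_pow, h.map_zero, mul_pow, mul_pow, map_pow]
  map i := by
    have : ExpChar Λ p := expChar_of_injective_algebraMap (algebraMap E Λ).injective p
    simp [h.map, add_pow_expChar, mul_pow]

theorem IsSolution.aeval_mem (h : S.IsSolution κ a b G₀ G) (P : MvPolynomial ι E) :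
    aeval G P ∈ S.M := by
  rw [aeval_def, eval₂_eq]
  exact sum_mem fun α _ => mul_mem (S.algebraMap_mem _)
    (prod_mem fun i _ => pow_mem (h.mem i) (α i))

theorem IsSolution.totalDegree_eq_one [LinearOrder ι] [WellFoundedGT ι]
    (h : S.IsSolution κ a b G₀ G) (htr : Transcendental E G₀) {P : MvPolynomial ι E} {μ : E}
    (hP : affineSubst S.σE (fun _ => a) b P = C μ * P) {i : ι}
    (hconst : (pderiv i P).totalDegree = 0) (hne : pderiv i P ≠ 0) : P.totalDegree = 1 := by
  set c := coeff (Finsupp.single i 1) P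
  set r := MonomialOrder.degLex.leadingCoeff P
  have hc : c ≠ 0 := fun h0 => hne (by rw [pderiv_eq_C hconst, C_eq_zero]; exact h0)
  have hr : r ≠ 0 := MonomialOrder.degLex.leadingCoeff_ne_zero_iff.2 fun h0 => hne (by simp [h0])
  have hσc : S.σE c = μ / a * c := map_coeff_single_eq h.ne_zero hP hconst
  have hσr : S.σE r * a ^ P.totalDegree = μ * r := map_leadingCoeff_mul_pow_eq hP
  have hdeg : P.totalDegree ≠ 0 := fun h0 => hne (by
    rw [totalDegree_eq_zero_iff_eq_C.1 h0, pderiv_C])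
  obtain ⟨m, hm⟩ := Nat.exists_eq_succ_of_ne_zero hdeg
  suffices m = 0 by rw [hm, this]
  by_contra hm0
  -- If `m ≠ 0` then `(c / r) / G₀ ^ m` is a constant, so that `G₀` is algebraic over `E`.
  have hσ : S.σE (c / r) = a ^ m * (c / r) := by
    have hσr0 : S.σE r ≠ 0 := by simpa using hr
    have ha := h.ne_zero
    rw [map_div₀, hσc, div_eq_iff hσr0]
    field_simp
    rw [← pow_succ', ← hσr, hm, mul_comm]
  have hmem : algebraMap E Λ (c / r) / G₀ ^ m ∈ S.const :=
    h.div_pow_mem_const (S.algebraMap_mem _) (by rw [S.map_algebraMap, hσ, map_mul, map_pow])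
  have hcr : algebraMap E Λ (c / r) ≠ 0 := by simpa using ⟨hc, hr⟩
  refine htr (IsAlgebraic.of_pow (Nat.pos_of_ne_zero hm0) ?_)
  rw [← div_div_cancel₀ hcr (b := G₀ ^ m)]
  exact div_eq_mul_inv (algebraMap E Λ (c / r)) _ ▸
    (isAlgebraic_algebraMap _).mul (S.isAlgebraic _ hmem).inv

variable [Fintype ι]

theorem IsSolution.hasLinearRelation_of_totalDegree_eq_one (h : S.IsSolution κ a b G₀ G)
    (hG₀ : G₀ ≠ 0) {P : MvPolynomial ι E} {μ : E}
    (hP : affineSubst S.σE (fun _ => a) b P = C μ * P) (hdeg : P.totalDegree = 1) {i : ι}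
    (hne : pderiv i P ≠ 0) : S.HasLinearRelation G₀ G := by
  set c : ι → E := fun j => coeff (Finsupp.single j 1) P with hc
  have hpderiv (j : ι) : (pderiv j P).totalDegree = 0 := by
    have := totalDegree_pderiv_lt j (P := P) (by simp [hdeg])
    lia
  have hσc (j : ι) : S.σE (c j) = μ / a * c j := map_coeff_single_eq h.ne_zero hP (hpderiv j)
  have hci : c i ≠ 0 := fun h0 => hne (by rw [pderiv_eq_C (hpderiv i)]; simpa using h0)
  have hσci : μ / a * c i ≠ 0 := hσc i ▸ (map_ne_zero S.σE).2 hci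
  have hμ : μ / a ≠ 0 := left_ne_zero_of_mul hσci
  have hconst (j : ι) : algebraMap E Λ (c j / c i) ∈ S.const := by
    refine S.const_of_eigenvector 1 (one_mem _) _ (S.algebraMap_mem _) ?_
    rw [S.map_algebraMap, one_mul, map_div₀, hσc, hσc, mul_div_mul_left _ _ hμ]
  set y := aeval G P / algebraMap E Λ (c i) with hy
  have hσy : S.σ y = algebraMap E Λ a ^ 1 * y := by
    have haeval := aeval_affineSubst S.σE (fun _ => a) b S.map_algebraMap h.map P
    rw [hP, map_mul, aeval_C] at haeval
    have hμa : μ = μ / a * a := (div_mul_cancel₀ _ h.ne_zero).symm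
    rw [hy, map_div₀, ← haeval, S.map_algebraMap, hσc, hμa, mul_div_cancel_right₀ _ h.ne_zero,
      map_mul, map_mul, mul_assoc, mul_div_mul_left _ _ (by simpa using hμ), pow_one, mul_div_assoc]
  have hyconst := h.div_pow_mem_const (div_mem (h.aeval_mem P) (S.algebraMap_mem _)) hσy
  rw [pow_one] at hyconst
  refine ⟨⟨-(y / G₀), neg_mem hyconst⟩, fun j => ⟨_, hconst j⟩, fun h0 => ?_, ?_⟩
  · simpa [hci] using congrArg Subtype.val (congrFun h0 i)
  · have haeval : aeval G P = algebraMap E Λ (coeff 0 P) + ∑ j, algebraMap E Λ (c j) * G j := by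
      conv_lhs => rw [eq_C_add_sum_C_mul_X hdeg.le]
      simp [hc]
    have hsum : -(y / G₀) * G₀ + ∑ j, algebraMap E Λ (c j / c i) * G j =
        algebraMap E Λ (-(coeff 0 P / c i)) := by
      rw [neg_mul, div_mul_cancel₀ _ hG₀, hy, haeval]
      simp only [map_neg, map_div₀, add_div, Finset.sum_div, div_mul_eq_mul_div]
      ring
    exact hsum ▸ isAlgebraic_algebraMap _

theorem HasLinearRelation.of_pow [hp : Fact p.Prime] [CharP E p]
    (h : S.HasLinearRelation (G₀ ^ p) (G ^ p)) : S.HasLinearRelation G₀ G := by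
  have : CharP Λ p := charP_of_injective_algebraMap (algebraMap E Λ).injective p
  obtain ⟨c₀, c, hc, halg⟩ := h
  obtain ⟨γ₀, rfl⟩ := S.perfect c₀
  choose γ hγ using fun i => S.perfect (c i)
  refine ⟨γ₀, γ, ?_, IsAlgebraic.of_pow hp.out.pos ?_⟩
  · rintro rfl
    exact hc (funext fun i => by simp [← hγ i, hp.out.ne_zero])
  · simpa [add_pow_char, sum_pow_char, mul_pow, ← hγ] using halg

theorem IsSolution.hasLinearRelation [LinearOrder ι] [hp : Fact p.Prime] [CharP E p]
    (h : S.IsSolution κ a b G₀ G) (htr : Transcendental E G₀) {P : MvPolynomial ι E} {μ : E}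
    (hP : affineSubst S.σE (fun _ => a) b P = C μ * P) (hdeg : P.totalDegree ≠ 0) :
    S.HasLinearRelation G₀ G := by
  have : ExpChar E p := ExpChar.prime hp.out
  induction hD : P.totalDegree using Nat.strong_induction_on generalizing P κ a b G₀ G μ with
  | _ D ih =>
  subst hD
  by_cases! hderiv : ∃ i, (pderiv i P).totalDegree ≠ 0
  · obtain ⟨i, hi⟩ := hderiv
    exact ih _ (totalDegree_pderiv_lt i hdeg) h htr (affineSubst_pderiv_eq_C_mul h.ne_zero hP) hi
      rfl
  by_cases! hzero : ∀ i, pderiv i P = 0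
  · obtain ⟨T, rfl⟩ := exists_expand_eq_of_pderiv_eq_zero p hzero
    rw [totalDegree_expand] at hdeg ih
    have hT : T.totalDegree ≠ 0 := left_ne_zero_of_mul hdeg
    exact (ih _ (lt_mul_of_one_lt_right (Nat.pos_of_ne_zero hT) hp.out.one_lt) h.pow
      (htr.pow hp.out.pos) (affineSubst_eq_C_mul_of_expand p hP) hT rfl).of_pow
  obtain ⟨i, hi⟩ := hzero
  exact h.hasLinearRelation_of_totalDegree_eq_one (fun h0 => htr (h0 ▸ isAlgebraic_zero)) hP
    (h.totalDegree_eq_one htr hP (hderiv i) hi) hi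

section Dependence

variable {n : ℕ} {κ a : E} {b : Fin n → E} {G : Fin n → Λ}

theorem IsSolution.exists_relation_eigenvector (h : S.IsSolution (algebraMap E Λ κ) a b G₀ G)
    (hdep : ¬ AlgebraicIndependent E (Fin.cons G₀ G : Fin (n + 1) → Λ)) :
    ∃ P : MvPolynomial (Fin (n + 1)) E,
      P ≠ 0 ∧ aeval (Fin.cons G₀ G : Fin (n + 1) → Λ) P = 0 ∧
        ∃ μ, affineSubst S.σE (Fin.cons (κ * a) fun _ => a) (Fin.cons 0 b) P = C μ * P := by
  set x : Fin (n + 1) → Λ := Fin.cons G₀ G with hx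
  have hσx : ∀ i, S.σ (x i) =
      algebraMap E Λ ((Fin.cons (κ * a) fun _ => a : Fin (n + 1) → E) i) * x i +
        algebraMap E Λ ((Fin.cons 0 b : Fin (n + 1) → E) i) :=
    Fin.cases (by simp [hx, h.map_zero]) fun i => by simp [hx, h.map]
  obtain ⟨P, hPI, hP, hμ⟩ := exists_affineSubst_eq_C_mul S.σE
    (Fin.cons (κ * a) fun _ => a : Fin (n + 1) → E) (Fin.cons 0 b) MonomialOrder.lex
    (I := RingHom.ker (aeval x : MvPolynomial (Fin (n + 1)) E →ₐ[E] Λ))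
    (fun P hP => by
      rw [RingHom.mem_ker] at hP ⊢
      rw [aeval_affineSubst _ _ _ S.map_algebraMap hσx, hP, RingHom.map_zero])
    fun h => hdep ((RingHom.injective_iff_ker_eq_bot _).2 h)
  exact ⟨P, hP, hPI, hμ⟩

theorem IsSolution.exists_linear_relation [Fact p.Prime] [CharP E p]
    (h : S.IsSolution (algebraMap E Λ κ) a b G₀ G)
    (hdep : ¬ AlgebraicIndependent E (Fin.cons G₀ G : Fin (n + 1) → Λ)) :
    ∃ c : Fin (n + 1) → S.const, c ≠ 0 ∧
      IsAlgebraic E (∑ i, c i * (Fin.cons G₀ G : Fin (n + 1) → Λ) i) := by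
  by_cases! htr : IsAlgebraic E G₀
  · refine ⟨Fin.cons 1 0, fun h0 => one_ne_zero (congrFun h0 0), ?_⟩
    simpa [Fin.sum_univ_succ] using htr
  suffices S.HasLinearRelation G₀ G by
    obtain ⟨c₀, c, hc, halg⟩ := this
    refine ⟨Fin.cons c₀ c, fun h0 => hc (funext fun i => congrFun h0 i.succ), ?_⟩
    simpa [Fin.sum_univ_succ] using halg
  have hκa : κ * a ≠ 0 := by
    refine mul_ne_zero (fun hκ => htr ?_) h.ne_zero
    have hσ := h.map_zero
    rw [hκ, RingHom.map_zero, zero_mul, zero_mul, map_eq_zero] at hσ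
    exact hσ ▸ isAlgebraic_zero
  obtain ⟨P, hP, hPx, μ, hμ⟩ := h.exists_relation_eigenvector hdep
  by_contra hnot
  -- If no coefficient of `P` in `X₀` involves the other variables, `P` is a relation for `G₀`.
  refine htr (isAlgebraic_of_finSuccEquiv_coeff_totalDegree_eq_zero hP hPx fun j => ?_)
  by_contra hj
  exact hnot (h.hasLinearRelation htr (affineSubst_coeff_finSuccEquiv_eq_C_mul hκa hμ j) hj)

end Dependence

end DifferenceExtension

end DifferenceFields

/-! ### The absolute value of `ℂ_∞` -/

section Norm

theorem norm_eq_one_of_pow_eq_self {A : Type*} [NormedDivisionRing A] {c : A} {N : ℕ} (hN : 1 < N)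
    (hc : c ^ N = c) (h0 : c ≠ 0) : ‖c‖ = 1 := by
  obtain ⟨m, rfl⟩ := Nat.exists_eq_succ_of_ne_zero (Nat.ne_zero_of_lt hN)
  have hpow : c ^ m = 1 := mul_right_cancel₀ h0 (by rw [← pow_succ, hc, one_mul])
  have hm : m ≠ 0 := by lia
  exact (pow_eq_one_iff_of_nonneg (norm_nonneg c) hm).1 (by rw [← norm_pow, hpow, norm_one])

theorem norm_le_one_of_pow_eq_self {A : Type*} [NormedDivisionRing A] {c : A} {N : ℕ} (hN : 1 < N)
    (hc : c ^ N = c) : ‖c‖ ≤ 1 := by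
  rcases eq_or_ne c 0 with rfl | h0
  · simp
  · exact (norm_eq_one_of_pow_eq_self hN hc h0).le

theorem summable_norm_mul_pow {A : Type*} [NormedDivisionRing A] {u : A} (hu : ‖u‖ < 1)
    {c : ℕ → A} (hc : ∀ j, ‖c j‖ ≤ 1) : Summable fun j => ‖c j * u ^ j‖ := by
  refine Summable.of_nonneg_of_le (fun _ => norm_nonneg _) (fun j => ?_)
    (summable_geometric_of_lt_one (norm_nonneg u) hu)
  rw [norm_mul, norm_pow]
  exact mul_le_of_le_one_left (by positivity) (hc j)

variable (Fq : Type*) [Field Fq] [Finite Fq]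

instance : IsUltrametricDist (CInf Fq) := by
  refine IsUltrametricDist.isUltrametricDist_of_forall_norm_add_le_max_norm fun x y => ?_
  refine UniformSpace.Completion.induction_on₂ x y
    (isClosed_le (by fun_prop) (by fun_prop)) fun a b => ?_
  rw [← UniformSpace.Completion.coe_add, UniformSpace.Completion.norm_coe,
    UniformSpace.Completion.norm_coe, UniformSpace.Completion.norm_coe]
  exact isNonarchimedean_spectralNorm (K := KInf Fq) (L := AlgebraicClosure (KInf Fq)) a b

theorem norm_invThetaInf : ‖invThetaInf Fq‖ = (q Fq : ℝ)⁻¹ := by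
  have hnorm : ‖invThetaInf Fq‖ = ((WithZeroMulInt.toNNReal (one_pos.trans (one_lt_q Fq)).ne')
      ((Valued.v : Valuation (KInf Fq) ℤᵐ⁰) (invThetaInf Fq)) : ℝ≥0) := by
    rw [← Valuation.embedding_restrict]
    rfl
  rw [hnorm, valued_invThetaInf, WithZeroMulInt.toNNReal_neg_apply _ (by simp),
    show (WithZero.unzero (WithZero.exp_ne_zero (a := (-1 : ℤ)))).toAdd = -1 from rfl]
  simp

theorem norm_theta : ‖theta Fq‖ = q Fq := by
  rw [theta, UniformSpace.Completion.norm_coe, ← inv_inv (q Fq : ℝ), ← norm_invThetaInf, ← norm_inv]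
  exact spectralNorm_extends _

end Norm

/-! ### Expansions in powers of `u` -/

section Expansion

open PowerSeries

variable {Fq : Type*} [Field Fq] [Finite Fq] {d : ℕ} {u x y : CInf Fq} {f g : (CInf Fq)⟦X⟧}

theorem one_lt_q_pow (hd : 1 ≤ d) : 1 < q Fq ^ d :=
  Nat.one_lt_pow (Nat.one_le_iff_ne_zero.1 hd) (Finite.one_lt_card (α := Fq))

variable (Fq) in
/-- The `q^d`-power Frobenius endomorphism of `ℂ_∞`. -/
noncomputable def frob (d : ℕ) : CInf Fq →+* CInf Fq :=
  letI := Fintype.ofFinite Fq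
  (FiniteField.frobeniusAlgHom Fq (CInf Fq) ^ d : CInf Fq →ₐ[Fq] CInf Fq)

@[simp]
theorem frob_apply (d : ℕ) (x : CInf Fq) : frob Fq d x = x ^ (q Fq ^ d) := by
  let := Fintype.ofFinite Fq
  rw [q, Nat.card_eq_fintype_card]
  simp [frob, FiniteField.coe_frobeniusAlgHom, pow_iterate]

theorem frob_algebraMap (d : ℕ) (c : Fq) :
    frob Fq d (algebraMap Fq (CInf Fq) c) = algebraMap Fq (CInf Fq) c :=
  AlgHom.commutes _ c

theorem map_frob_eq_self_iff :
    PowerSeries.map (frob Fq d) f = f ↔ ∀ j, coeff j f ^ (q Fq ^ d) = coeff j f := by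
  simp [PowerSeries.ext_iff]

theorem IsExpansion.map_frob (hf : IsExpansion d u f x) : PowerSeries.map (frob Fq d) f = f :=
  map_frob_eq_self_iff.2 hf.1

theorem IsExpansion.norm_coeff_le_one (hd : 1 ≤ d) (hf : IsExpansion d u f x) (j : ℕ) :
    ‖coeff j f‖ ≤ 1 :=
  norm_le_one_of_pow_eq_self (one_lt_q_pow hd) (hf.1 j)

theorem IsExpansion.add (hf : IsExpansion d u f x) (hg : IsExpansion d u g y) :
    IsExpansion d u (f + g) (x + y) := by
  refine ⟨map_frob_eq_self_iff.1 (by rw [map_add, hf.map_frob, hg.map_frob]), ?_⟩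
  simpa [add_mul] using hf.2.add hg.2

theorem IsExpansion.mul (hd : 1 ≤ d) (hu : ‖u‖ < 1) (hf : IsExpansion d u f x)
    (hg : IsExpansion d u g y) : IsExpansion d u (f * g) (x * y) := by
  refine ⟨map_frob_eq_self_iff.1 (by rw [map_mul, hf.map_frob, hg.map_frob]), ?_⟩
  have hf' := summable_norm_mul_pow hu (hf.norm_coeff_le_one hd)
  have hg' := summable_norm_mul_pow hu (hg.norm_coeff_le_one hd)
  rw [← hf.2.tsum_eq, ← hg.2.tsum_eq,
    tsum_mul_tsum_eq_tsum_sum_antidiagonal_of_summable_norm hf' hg']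
  refine (summable_norm_sum_mul_antidiagonal_of_summable_norm hf' hg').of_norm.hasSum.congr_fun
    fun j => ?_
  rw [PowerSeries.coeff_mul, Finset.sum_mul]
  refine Finset.sum_congr rfl fun ij hij => ?_
  rw [← Finset.HasAntidiagonal.mem_antidiagonal.1 hij, pow_add, mul_mul_mul_comm]

theorem isExpansion_C {c : CInf Fq} (hc : frob Fq d c = c) : IsExpansion d u (C c) c := by
  refine ⟨map_frob_eq_self_iff.1 (by rw [PowerSeries.map_C, hc]), ?_⟩
  convert hasSum_single 0 fun j hj => ?_ using 1
  · simp
  · simp [coeff_C, hj]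

theorem isExpansion_X : IsExpansion d u X u := by
  refine ⟨map_frob_eq_self_iff.1 (PowerSeries.map_X _), ?_⟩
  convert hasSum_single 1 fun j hj => ?_ using 1
  · simp
  · simp [coeff_X, hj]

theorem IsExpansion.norm_le_one (hd : 1 ≤ d) (hu : ‖u‖ < 1) (hf : IsExpansion d u f x) :
    ‖x‖ ≤ 1 := by
  refine (isClosed_le continuous_norm continuous_const).mem_of_tendsto hf.2
    (Filter.Eventually.of_forall fun s => ?_)
  refine IsUltrametricDist.norm_sum_le_of_forall_le_of_nonneg zero_le_one fun j _ => ?_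
  rw [norm_mul, norm_pow]
  exact mul_le_one₀ (hf.norm_coeff_le_one hd j) (by positivity)
    (pow_le_one₀ (norm_nonneg u) hu.le)

theorem IsExpansion.exists_shift (hd : 1 ≤ d) (hu : ‖u‖ < 1) (hf : IsExpansion d u f x) :
    ∃ y, IsExpansion d u (mk fun j => coeff (j + 1) f) y ∧ x = u * y + constantCoeff f := by
  obtain ⟨y, hy⟩ := (summable_norm_mul_pow hu fun j => hf.norm_coeff_le_one hd (j + 1)).of_norm
  have hshift : IsExpansion d u (mk fun j => coeff (j + 1) f) y :=
    ⟨fun j => by simpa using hf.1 (j + 1), by simpa using hy⟩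
  have hC : IsExpansion d u (C (constantCoeff f)) (constantCoeff f) :=
    isExpansion_C (by simpa using hf.1 0)
  have hsum := (isExpansion_X.mul hd hu hshift).add hC
  rw [← eq_X_mul_shift_add_const] at hsum
  exact ⟨y, hshift, hf.2.unique hsum.2⟩

theorem IsExpansion.constantCoeff_eq_zero (hd : 1 ≤ d) (hu : ‖u‖ < 1) (hf : IsExpansion d u f x)
    (hx : ‖x‖ < 1) : constantCoeff f = 0 := by
  by_contra h0
  obtain ⟨y, hy, rfl⟩ := hf.exists_shift hd hu
  have huy : ‖u * y‖ < 1 := by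
    rw [norm_mul]
    exact (mul_le_of_le_one_right (norm_nonneg u) (hy.norm_le_one hd hu)).trans_lt hu
  have hlt : ‖constantCoeff f‖ < 1 := by
    rw [← neg_add_cancel_left (u * y) (constantCoeff f)]
    exact (IsUltrametricDist.norm_add_le_max _ _).trans_lt (max_lt (by rwa [norm_neg]) hx)
  exact hlt.ne (norm_eq_one_of_pow_eq_self (one_lt_q_pow hd) (by simpa using hf.1 0) h0)

theorem IsExpansion.eq_zero (hd : 1 ≤ d) (hu0 : u ≠ 0) (hu : ‖u‖ < 1)
    (hf : IsExpansion d u f 0) : f = 0 := by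
  ext j
  rw [map_zero]
  induction j generalizing f with
  | zero => simpa using hf.constantCoeff_eq_zero hd hu (by simp)
  | succ j ih =>
    obtain ⟨y, hy, hxy⟩ := hf.exists_shift hd hu
    rw [hf.constantCoeff_eq_zero hd hu (by simp), add_zero, eq_comm, mul_eq_zero] at hxy
    obtain rfl := hxy.resolve_left hu0
    simpa using ih hy

theorem IsExpansion.aeval (hd : 1 ≤ d) (hu : ‖u‖ < 1) {ι : Type*} {f : ι → (CInf Fq)⟦X⟧}
    {x : ι → CInf Fq} (hf : ∀ i, IsExpansion d u (f i) (x i)) (P : MvPolynomial ι Fq) :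
    IsExpansion d u (MvPolynomial.aeval f P) (MvPolynomial.aeval x P) := by
  induction P using MvPolynomial.induction_on with
  | C c =>
    rw [MvPolynomial.aeval_C, MvPolynomial.aeval_C, PowerSeries.algebraMap_apply]
    exact isExpansion_C (frob_algebraMap d c)
  | add P Q hP hQ =>
    rw [map_add, map_add]
    exact hP.add hQ
  | mul_X P i hP =>
    rw [map_mul, map_mul, MvPolynomial.aeval_X, MvPolynomial.aeval_X]
    exact hP.mul hd hu (hf i)

theorem IsExpansion.algebraicIndependent (hd : 1 ≤ d) (hu0 : u ≠ 0) (hu : ‖u‖ < 1) {ι : Type*}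
    {f : ι → (CInf Fq)⟦X⟧} {x : ι → CInf Fq} (hf : ∀ i, IsExpansion d u (f i) (x i))
    (hind : AlgebraicIndependent Fq f) : AlgebraicIndependent Fq x :=
  algebraicIndependent_iff.2 fun P hP =>
    algebraicIndependent_iff.1 hind P ((hP ▸ IsExpansion.aeval hd hu hf P).eq_zero hd hu0 hu)

end Expansion

/-! ### Algebraicity of expansions -/

section Algebraicity

theorem not_algebraicIndependent_of_isAlgebraic_adjoin_simple {F L ι : Type*} [Field F] [Field L]
    [Algebra F L] [Nontrivial ι] {t : L} {x : ι → L}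
    (hx : ∀ i, IsAlgebraic (IntermediateField.adjoin F {t}) (x i)) :
    ¬ AlgebraicIndependent F x := by
  intro hind
  have hclosure : Set.range x ⊆ (AlgebraicIndependent.matroid F L).closure {t} := by
    rintro - ⟨i, rfl⟩
    rw [AlgebraicIndependent.matroid_closure_eq]
    exact IntermediateField.isAlgebraic_adjoin_iff.1 (hx i)
  have hcard := Matroid.Indep.encard_le_eRk_of_subset (M := AlgebraicIndependent.matroid F L)
    (hind.to_subtype_range) hclosure
  rw [Matroid.eRk_closure_eq] at hcard
  refine hcard.not_gt (((AlgebraicIndependent.matroid F L).eRk_le_encard {t}).trans_lt ?_)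
  rw [Set.encard_singleton, Set.one_lt_encard_iff_nontrivial]
  obtain ⟨i, j, hij⟩ := exists_pair_ne ι
  exact ⟨x i, ⟨i, rfl⟩, x j, ⟨j, rfl⟩, hind.injective.ne hij⟩

theorem transcendental_single_one (L : Type*) [Field L] :
    Transcendental L (HahnSeries.single 1 1 : L⸨X⸩) := by
  let ψ : L⟦X⟧ →ₐ[L] L⸨X⸩ := { HahnSeries.ofPowerSeries ℤ L with commutes' := fun _ => rfl }
  let φ : Polynomial L →ₐ[L] L⸨X⸩ := ψ.comp (Polynomial.coeToPowerSeries.algHom L)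
  have hφ : Function.Injective φ :=
    HahnSeries.ofPowerSeries_injective.comp (Polynomial.coe_injective L)
  have hX : φ Polynomial.X = HahnSeries.single 1 1 := by simp [φ, ψ]
  rw [← hX, Transcendental, isAlgebraic_algHom_iff φ hφ]
  exact Polynomial.transcendental_X L

variable {Fq : Type*} [Field Fq] [Finite Fq] {d : ℕ} {u x : CInf Fq} {f : (CInf Fq)⟦X⟧}

theorem IsExpansion.isAlgebraic (hd : 1 ≤ d) (hu0 : u ≠ 0) (hu : ‖u‖ < 1) (huk : u ∈ kBar Fq)
    (hxk : x ∈ kBar Fq) (hf : IsExpansion d u f x) : IsAlgebraic (kZ Fq) (f : (CInf Fq)⸨X⸩) := by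
  by_contra htr
  have hZ : AlgebraicIndependent (k Fq) fun _ : Unit => (HahnSeries.single 1 1 : (CInf Fq)⸨X⸩) :=
    algebraicIndependent_unique_type_iff.2 <|
      (transcendental_single_one _).restrictScalars (algebraMap (k Fq) (CInf Fq)).injective
  have hfZ : AlgebraicIndependent (k Fq) fun o : Option Unit =>
      o.elim (f : (CInf Fq)⸨X⸩) fun _ => HahnSeries.single 1 1 := by
    rw [hZ.option_iff_transcendental, Set.range_const]
    exact IntermediateField.transcendental_adjoin_iff.1 htr
  have hfX : AlgebraicIndependent (k Fq) fun o : Option Unit => o.elim f fun _ => .X := by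
    let ψ : (CInf Fq)⟦X⟧ →ₐ[k Fq] (CInf Fq)⸨X⸩ :=
      { HahnSeries.ofPowerSeries ℤ (CInf Fq) with commutes' := fun _ => rfl }
    refine .of_comp ψ ?_
    convert hfZ using 1
    ext1 (_ | _)
    exacts [rfl, PowerSeries.coe_X]
  have hxu : AlgebraicIndependent Fq fun o : Option Unit => o.elim x fun _ => u :=
    IsExpansion.algebraicIndependent hd hu0 hu (by rintro (_ | _); exacts [hf, isExpansion_X])
      (hfX.restrictScalars (algebraMap Fq (k Fq)).injective)
  refine not_algebraicIndependent_of_isAlgebraic_adjoin_simple (t := theta Fq) ?_ hxu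
  rintro (_ | _)
  exacts [mem_algebraicClosure_iff.1 hxk, mem_algebraicClosure_iff.1 huk]

end Algebraicity

/-! ### The substitution `Z ↦ Z^N` in Laurent series -/

section Mahler

variable {R : Type*} [CommRing R] {N : ℕ} (hN : N ≠ 0)

/-- The Mahler operator `f(Z) ↦ f(Z^N)` on Laurent series. -/
noncomputable def mahler (R : Type*) [CommRing R] (N : ℕ) (hN : N ≠ 0) : R⸨X⸩ →+* R⸨X⸩ :=
  HahnSeries.embDomainRingHom (AddMonoidHom.mulLeft (N : ℤ))
    (mul_right_injective₀ (by exact_mod_cast hN))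
    fun _ _ => mul_le_mul_iff_right₀ (by exact_mod_cast Nat.pos_of_ne_zero hN)

theorem coeff_mahler_mul (f : R⸨X⸩) (j : ℤ) : (mahler R N hN f).coeff (N * j) = f.coeff j :=
  HahnSeries.embDomain_coeff (a := j)

theorem coeff_mahler_of_not_dvd (f : R⸨X⸩) {j : ℤ} (hj : ¬ (N : ℤ) ∣ j) :
    (mahler R N hN f).coeff j = 0 := by
  refine HahnSeries.embDomain_of_notMem_range ?_
  rintro ⟨i, rfl⟩
  exact hj ⟨i, rfl⟩

theorem mahler_C (c : R) : mahler R N hN (HahnSeries.C c) = HahnSeries.C c :=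
  HahnSeries.embDomainRingHom_C

theorem mahler_coe (f : R⟦X⟧) :
    mahler R N hN (f : R⸨X⸩) = (PowerSeries.expand N hN f : R⟦X⟧) := by
  ext j
  by_cases hj : (N : ℤ) ∣ j
  · obtain ⟨i, rfl⟩ := hj
    have hneg : (N : ℤ) * i < 0 ↔ i < 0 := by
      simp [mul_neg_iff, Nat.pos_of_ne_zero hN]
    simp [coeff_mahler_mul, PowerSeries.coeff_coe, hneg, Int.natAbs_mul,
      PowerSeries.coeff_expand_mul]
  · rw [coeff_mahler_of_not_dvd hN _ hj, PowerSeries.coeff_coe,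
      PowerSeries.coeff_expand_of_not_dvd _ _ _ fun h => hj (Int.natCast_dvd.2 h), ite_self]

theorem eq_C_of_mahler_eq [NoZeroDivisors R] (hN1 : 1 < N) {κ : R} {g : R⸨X⸩}
    (h : mahler R N hN g = HahnSeries.C κ * g) : g = HahnSeries.C (g.coeff 0) := by
  have hcoeff (j : ℤ) : (mahler R N hN g).coeff j = κ * g.coeff j := by
    rw [h, HahnSeries.C_mul_eq_smul, HahnSeries.coeff_smul, smul_eq_mul]
  suffices hzero : ∀ j ≠ 0, g.coeff j = 0 by
    ext j
    rcases eq_or_ne j 0 with rfl | hj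
    · simp
    · rw [hzero j hj, HahnSeries.C_apply, HahnSeries.coeff_single_of_ne hj]
  intro j
  rcases eq_or_ne κ 0 with rfl | hκ
  · rw [← coeff_mahler_mul hN, hcoeff, zero_mul]
    exact fun _ => rfl
  induction hm : j.natAbs using Nat.strong_induction_on generalizing j with
  | _ m ih =>
  intro hj
  refine (mul_eq_zero.1 ?_).resolve_left hκ
  rw [← hcoeff]
  by_cases hdvd : (N : ℤ) ∣ j
  · obtain ⟨i, rfl⟩ := hdvd
    have hi : i ≠ 0 := right_ne_zero_of_mul hj
    rw [coeff_mahler_mul]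
    refine ih i.natAbs ?_ i rfl hi
    rw [← hm, Int.natAbs_mul, Int.natAbs_natCast]
    exact lt_mul_of_one_lt_left (Int.natAbs_pos.2 hi) hN1
  · exact coeff_mahler_of_not_dvd hN g hdvd

end Mahler

section LaurentSubfield

variable {L : Type*} [Field L] {F : Subfield L}

/-- The subfield `F((Z))` of `L((Z))`, for a subfield `F` of `L`. -/
noncomputable def laurentSubfield (F : Subfield L) : Subfield L⸨X⸩ :=
  ({ toFun := fun x : F⸨X⸩ => x.map F.subtype
     map_zero' := by ext; simp
     map_one' := HahnSeries.map_one F.subtype.toMonoidWithZeroHom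
     map_add' := fun x y => by ext; simp
     map_mul' := fun x y => HahnSeries.map_mul (F.subtype : F →ₙ+* L) } :
    F⸨X⸩ →+* L⸨X⸩).fieldRange

theorem mem_laurentSubfield_iff {f : L⸨X⸩} : f ∈ laurentSubfield F ↔ ∀ j, f.coeff j ∈ F := by
  constructor
  · rintro ⟨g, rfl⟩ j
    exact (g.coeff j).2
  · exact fun h => ⟨⟨fun j => ⟨f.coeff j, h j⟩,
      f.isPWO_support.mono fun j hj h0 => hj (Subtype.ext h0)⟩, rfl⟩

theorem coe_mem_laurentSubfield_iff {f : L⟦X⟧} :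
    (f : L⸨X⸩) ∈ laurentSubfield F ↔ ∀ j, PowerSeries.coeff j f ∈ F := by
  rw [mem_laurentSubfield_iff]
  refine ⟨fun h j => by simpa using h j, fun h j => ?_⟩
  rw [PowerSeries.coeff_coe]
  split_ifs
  exacts [zero_mem F, h _]

theorem C_mem_laurentSubfield {c : L} (hc : c ∈ F) : HahnSeries.C c ∈ laurentSubfield F := by
  rw [← PowerSeries.coe_C, coe_mem_laurentSubfield_iff]
  intro j
  rw [PowerSeries.coeff_C]
  split_ifs
  exacts [hc, zero_mem F]

theorem single_one_mem_laurentSubfield : HahnSeries.single 1 1 ∈ laurentSubfield F := by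
  rw [← PowerSeries.coe_X, coe_mem_laurentSubfield_iff]
  intro j
  rw [PowerSeries.coeff_X]
  split_ifs
  exacts [one_mem F, zero_mem F]

theorem mahler_mem_laurentSubfield {N : ℕ} (hN : N ≠ 0) {x : L⸨X⸩} (hx : x ∈ laurentSubfield F) :
    mahler L N hN x ∈ laurentSubfield F := by
  rw [mem_laurentSubfield_iff] at hx ⊢
  intro j
  by_cases hj : (N : ℤ) ∣ j
  · obtain ⟨i, rfl⟩ := hj
    rw [coeff_mahler_mul]
    exact hx i
  · rw [coeff_mahler_of_not_dvd hN x hj]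
    exact zero_mem F

end LaurentSubfield

/-! ### Limits of power series -/

section Limits

open PowerSeries
open scoped PowerSeries.WithPiTopology

theorem expand_inv {L : Type*} [Field L] {N : ℕ} (hN : N ≠ 0) (f : L⟦X⟧) :
    expand N hN f⁻¹ = (expand N hN f)⁻¹ := by
  by_cases hf : constantCoeff f = 0
  · rw [PowerSeries.inv_eq_zero.2 hf, map_zero, eq_comm, PowerSeries.inv_eq_zero,
      constantCoeff_expand, hf]
  · rw [PowerSeries.eq_inv_iff_mul_eq_one (by rwa [constantCoeff_expand]), ← map_mul,
      PowerSeries.inv_mul_cancel f hf, map_one]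

theorem coe_inv {L : Type*} [Field L] {f : L⟦X⟧} (hf : constantCoeff f ≠ 0) :
    ((f⁻¹ : L⟦X⟧) : L⸨X⸩) = (f : L⸨X⸩)⁻¹ :=
  eq_inv_of_mul_eq_one_left (by rw [← coe_mul, PowerSeries.inv_mul_cancel f hf, coe_one])

theorem X_pow_dvd_inv_pow_sub_one {L : Type*} [Field L] {f : L⟦X⟧} {m : ℕ}
    (hf : constantCoeff f ≠ 0) (h : X ^ m ∣ f - 1) (s : ℕ) : X ^ m ∣ f⁻¹ ^ s - 1 := by
  have hinv : X ^ m ∣ f⁻¹ - 1 := by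
    convert h.mul_left (-f⁻¹) using 1
    linear_combination PowerSeries.inv_mul_cancel f hf
  simpa using hinv.trans (sub_dvd_pow_sub_pow f⁻¹ 1 s)

variable {R : Type*} [CommRing R]

theorem X_pow_dvd_pow {f : R⟦X⟧} {m N : ℕ} (hf : constantCoeff f = 0) (hm : m ≤ N) :
    X ^ m ∣ f ^ N :=
  (pow_dvd_pow X hm).trans (pow_dvd_pow_of_dvd (X_dvd_iff.2 hf) N)

theorem tendsto_order_of_X_pow_dvd {f : ℕ → R⟦X⟧} (h : ∀ m, X ^ m ∣ f m) :
    Filter.Tendsto (fun m => (f m).order) Filter.atTop (nhds ⊤) := by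
  rw [ENat.tendsto_nhds_top_iff_natCast_lt]
  intro n
  filter_upwards [Filter.eventually_gt_atTop n] with m hm
  exact (Nat.cast_lt.2 hm).trans_le (nat_le_order _ _ (X_pow_dvd_iff.1 (h m)))

variable [TopologicalSpace R]

theorem continuous_expand {N : ℕ} (hN : N ≠ 0) : Continuous (expand (R := R) N hN) := by
  refine continuous_iff_continuousAt.2 fun f =>
    (WithPiTopology.tendsto_iff_coeff_tendsto R _ _ _).2 fun n => ?_
  simp only [coeff_expand]
  split_ifs
  exacts [(WithPiTopology.continuous_coeff R _).tendsto f, tendsto_const_nhds]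

theorem coeff_eq_of_tendsto [T2Space R] {f : ℕ → R⟦X⟧} {g : R⟦X⟧}
    (hstep : ∀ N, X ^ N ∣ f (N + 1) - f N) (hlim : Filter.Tendsto f Filter.atTop (nhds g))
    (n : ℕ) : coeff n g = coeff n (f (n + 1)) := by
  refine tendsto_nhds_unique ((WithPiTopology.tendsto_iff_coeff_tendsto R _ _ _).1 hlim n)
    (tendsto_const_nhds.congr' ?_)
  filter_upwards [Filter.eventually_ge_atTop (n + 1)] with N hN
  induction N, hN using Nat.le_induction with
  | base => rfl
  | succ N hN ih =>
    rw [ih, eq_comm, ← sub_eq_zero, ← map_sub]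
    exact X_pow_dvd_iff.1 (hstep N) n hN

theorem coe_mem_laurentSubfield_of_tendsto {L : Type*} [Field L] [TopologicalSpace L] [T2Space L]
    {F : Subfield L} {f : ℕ → L⟦X⟧} {g : L⟦X⟧} (hf : ∀ N, (f N : L⸨X⸩) ∈ laurentSubfield F)
    (hstep : ∀ N, X ^ N ∣ f (N + 1) - f N) (hlim : Filter.Tendsto f Filter.atTop (nhds g)) :
    (g : L⸨X⸩) ∈ laurentSubfield F := by
  rw [coe_mem_laurentSubfield_iff]
  intro n
  rw [coeff_eq_of_tendsto hstep hlim]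
  exact coe_mem_laurentSubfield_iff.1 (hf _) n

end Limits

/-! ### Functional equations of the interpolation series -/

section FunctionalEquations

open PowerSeries

variable {Fq : Type*} [Field Fq] [Finite Fq]

theorem q_pow_ne_zero (d : ℕ) : q Fq ^ d ≠ 0 := pow_ne_zero d Nat.card_pos.ne'

theorem le_q_pow (m : ℕ) : m ≤ q Fq ^ m :=
  (Nat.lt_pow_self (Finite.one_lt_card (α := Fq))).le

variable (Fq) in
theorem exists_q_eq_prime_pow : ∃ p r : ℕ, p.Prime ∧ CharP Fq p ∧ q Fq = p ^ r := by
  have := Fintype.ofFinite Fq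
  obtain ⟨p, hp⟩ := CharP.exists Fq
  obtain ⟨r, hpp, hr⟩ := FiniteField.card Fq p
  exact ⟨p, r, hpp, hp, by rw [← hr, q, Nat.card_eq_fintype_card]⟩

theorem IsExpansion.expand_eq_pow {d : ℕ} {u x : CInf Fq} {f : (CInf Fq)⟦X⟧}
    (hf : IsExpansion d u f x) :
    expand (q Fq ^ d) (q_pow_ne_zero d) f = f ^ (q Fq ^ d) := by
  obtain ⟨p, r, hp, hchar, hq⟩ := exists_q_eq_prime_pow Fq
  have : CharP (CInf Fq) p := charP_of_injective_algebraMap (algebraMap Fq (CInf Fq)).injective p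
  have : ExpChar (CInf Fq) p := ExpChar.prime hp
  have hqd : q Fq ^ d = p ^ (r * d) := by rw [hq, pow_mul]
  have hfrob : iterateFrobenius (CInf Fq) p (r * d) = frob Fq d := by
    ext x
    rw [frob_apply, iterateFrobenius_def, hqd]
  have hmap := MvPowerSeries.map_iterateFrobenius_expand p hp.ne_zero f (r * d)
  rw [hfrob] at hmap
  simp only [← hqd] at hmap
  rw [← hmap]
  exact (congrArg _ hf.map_frob).symm.trans (PowerSeries.map_expand _ _ _ f).symm

variable {d s : ℕ} {l li : (CInf Fq)⟦X⟧} {β : CInf Fq}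

/-- The factor `1 - θ 𝐥(Z)^(q^i)` of the products `π_m` and `G₀`. -/
noncomputable def carlitzFactor (l : (CInf Fq)⟦X⟧) (i : ℕ) : (CInf Fq)⟦X⟧ :=
  1 - C (theta Fq) * l ^ (q Fq ^ i)

/-- The partial sums of the series `GLog` that defines `G₁, …, Gₙ`. -/
noncomputable def gLogPartialSum (l li : (CInf Fq)⟦X⟧) (β : CInf Fq) (s N : ℕ) : (CInf Fq)⟦X⟧ :=
  ∑ m ∈ Finset.range N, li ^ (q Fq ^ m) * (piSeries l β s m)⁻¹

theorem piSeries_eq (l : (CInf Fq)⟦X⟧) (β : CInf Fq) (s m : ℕ) :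
    piSeries l β s m = C (β⁻¹ ^ m) * ∏ i ∈ Finset.range m, carlitzFactor l (i + 1) ^ s := by
  rw [piSeries, Finset.range_eq_Ico, Finset.prod_Ico_add' (fun i => carlitzFactor l i ^ s) 0 m 1]
  rfl

theorem constantCoeff_carlitzFactor (hl0 : constantCoeff l = 0) (i : ℕ) :
    constantCoeff (carlitzFactor l i) = 1 := by
  rw [carlitzFactor, map_sub, map_mul, map_pow, hl0, zero_pow (q_pow_ne_zero i), mul_zero, sub_zero,
    map_one]

theorem constantCoeff_carlitzFactor_ne_zero (hl0 : constantCoeff l = 0) (i : ℕ) :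
    constantCoeff (carlitzFactor l i) ≠ 0 := by
  simp [constantCoeff_carlitzFactor hl0]

theorem constantCoeff_piSeries_ne_zero (hl0 : constantCoeff l = 0) (hβ : β ≠ 0) (s m : ℕ) :
    constantCoeff (piSeries l β s m) ≠ 0 := by
  simp [piSeries_eq, map_prod, constantCoeff_carlitzFactor hl0, hβ]

theorem X_pow_dvd_carlitzFactor_inv_pow_sub_one (hl0 : constantCoeff l = 0) (s k m : ℕ) :
    X ^ m ∣ (carlitzFactor l (m + k))⁻¹ ^ s - 1 := by
  refine X_pow_dvd_inv_pow_sub_one (constantCoeff_carlitzFactor_ne_zero hl0 _) ?_ s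
  rw [carlitzFactor, sub_sub_cancel_left, dvd_neg]
  exact (X_pow_dvd_pow hl0 ((Nat.le_add_right m k).trans (le_q_pow _))).mul_left _

theorem X_pow_dvd_gLog_term (hli0 : constantCoeff li = 0) (f : (CInf Fq)⟦X⟧) (m : ℕ) :
    X ^ m ∣ li ^ (q Fq ^ m) * f :=
  (X_pow_dvd_pow hli0 (le_q_pow m)).mul_right f

theorem expand_carlitzFactor
    (hl : expand (q Fq ^ d) (q_pow_ne_zero d) l = l ^ (q Fq ^ d)) (i : ℕ) :
    expand (q Fq ^ d) (q_pow_ne_zero d) (carlitzFactor l i) = carlitzFactor l (i + d) := by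
  rw [carlitzFactor, map_sub, map_one, map_mul, map_pow, PowerSeries.expand_C, hl, ← pow_mul,
    ← pow_add, add_comm d i, carlitzFactor]

theorem expand_piSeries_mul (hl : expand (q Fq ^ d) (q_pow_ne_zero d) l = l ^ (q Fq ^ d))
    (β : CInf Fq) (s m : ℕ) :
    expand (q Fq ^ d) (q_pow_ne_zero d) (piSeries l β s m) * piSeries l β s d =
      piSeries l β s (m + d) := by
  have hindex (i : ℕ) : i + 1 + d = d + i + 1 := by lia
  rw [piSeries_eq, piSeries_eq, piSeries_eq, map_mul, PowerSeries.expand_C, map_prod,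
    add_comm m d, Finset.prod_range_add, pow_add, map_mul]
  simp only [map_pow, expand_carlitzFactor hl, hindex]
  ring

open scoped PowerSeries.WithPiTopology

theorem multipliable_carlitzFactor_inv_pow (hl0 : constantCoeff l = 0) (s k : ℕ) :
    Multipliable fun m => (carlitzFactor l (m + k))⁻¹ ^ s := by
  simpa using WithPiTopology.multipliable_one_add_of_tendsto_order_atTop_nhds_top (CInf Fq)
    (tendsto_order_of_X_pow_dvd (X_pow_dvd_carlitzFactor_inv_pow_sub_one hl0 s k))

theorem summable_gLog_term (hli0 : constantCoeff li = 0) (f : ℕ → (CInf Fq)⟦X⟧) :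
    Summable fun m => li ^ (q Fq ^ m) * f m :=
  WithPiTopology.summable_of_tendsto_order_atTop_nhds_top _
    (tendsto_order_of_X_pow_dvd fun m => X_pow_dvd_gLog_term hli0 (f m) m)

theorem prod_carlitzFactor_mul_GZero (hl0 : constantCoeff l = 0) (s d : ℕ) :
    (∏ m ∈ Finset.range d, carlitzFactor l (m + 1) ^ s) * GZero l s =
      ∏' m, (carlitzFactor l (m + d + 1))⁻¹ ^ s := by
  have hprod : (∏ m ∈ Finset.range d, (carlitzFactor l (m + 1))⁻¹ ^ s) *
      ∏' m, (carlitzFactor l (m + d + 1))⁻¹ ^ s = GZero l s :=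
    (multipliable_carlitzFactor_inv_pow hl0 s (d + 1)).prod_mul_tprod_nat_mul'
      (f := fun m => (carlitzFactor l (m + 1))⁻¹ ^ s)
  rw [← hprod, ← mul_assoc, ← Finset.prod_mul_distrib, Finset.prod_eq_one, one_mul]
  intro i _
  rw [← mul_pow, PowerSeries.mul_inv_cancel _ (constantCoeff_carlitzFactor_ne_zero hl0 _), one_pow]

theorem expand_GZero (hl0 : constantCoeff l = 0)
    (hl : expand (q Fq ^ d) (q_pow_ne_zero d) l = l ^ (q Fq ^ d)) (hβ : β ≠ 0) (s : ℕ) :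
    expand (q Fq ^ d) (q_pow_ne_zero d) (GZero l s) =
      C (β ^ d) * piSeries l β s d * GZero l s := by
  have hterm (m : ℕ) : expand (q Fq ^ d) (q_pow_ne_zero d) ((carlitzFactor l (m + 1))⁻¹ ^ s) =
      (carlitzFactor l (m + d + 1))⁻¹ ^ s := by
    rw [map_pow, expand_inv, expand_carlitzFactor hl, add_right_comm]
  calc expand (q Fq ^ d) (q_pow_ne_zero d) (GZero l s)
      = ∏' m, (carlitzFactor l (m + d + 1))⁻¹ ^ s :=
        ((multipliable_carlitzFactor_inv_pow hl0 s 1).map_tprod _ (continuous_expand _)).trans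
          (tprod_congr hterm)
    _ = (∏ m ∈ Finset.range d, carlitzFactor l (m + 1) ^ s) * GZero l s :=
        (prod_carlitzFactor_mul_GZero hl0 s d).symm
    _ = C (β ^ d) * piSeries l β s d * GZero l s := by
        rw [piSeries_eq, ← mul_assoc (C _) (C _), ← map_mul, ← mul_pow, mul_inv_cancel₀ hβ,
          one_pow, map_one, one_mul]

theorem expand_GLog (hl0 : constantCoeff l = 0)
    (hl : expand (q Fq ^ d) (q_pow_ne_zero d) l = l ^ (q Fq ^ d)) (hβ : β ≠ 0) (s : ℕ)
    (hli0 : constantCoeff li = 0)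
    (hli : expand (q Fq ^ d) (q_pow_ne_zero d) li = li ^ (q Fq ^ d)) :
    expand (q Fq ^ d) (q_pow_ne_zero d) (GLog l li β s) =
      piSeries l β s d * (GLog l li β s - gLogPartialSum l li β s d) := by
  have hc := constantCoeff_piSeries_ne_zero hl0 hβ s
  have hsum := summable_gLog_term hli0 fun m => (piSeries l β s m)⁻¹
  have hinv (m : ℕ) : expand (q Fq ^ d) (q_pow_ne_zero d) (piSeries l β s m)⁻¹ =
      piSeries l β s d * (piSeries l β s (m + d))⁻¹ := by
    rw [PowerSeries.eq_mul_inv_iff_mul_eq (hc _), ← expand_piSeries_mul hl, ← mul_assoc,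
      ← map_mul, PowerSeries.inv_mul_cancel _ (hc m), map_one, one_mul]
  have hterm (m : ℕ) :
      expand (q Fq ^ d) (q_pow_ne_zero d) (li ^ (q Fq ^ m) * (piSeries l β s m)⁻¹) =
        piSeries l β s d * (li ^ (q Fq ^ (m + d)) * (piSeries l β s (m + d))⁻¹) := by
    rw [map_mul, map_pow, hli, hinv, ← pow_mul, ← pow_add, add_comm d m, mul_left_comm]
  calc expand (q Fq ^ d) (q_pow_ne_zero d) (GLog l li β s)
      = ∑' m, piSeries l β s d * (li ^ (q Fq ^ (m + d)) * (piSeries l β s (m + d))⁻¹) :=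
        (hsum.map_tsum _ (continuous_expand _)).trans (tsum_congr hterm)
    _ = piSeries l β s d * ∑' m, li ^ (q Fq ^ (m + d)) * (piSeries l β s (m + d))⁻¹ :=
        ((summable_nat_add_iff d).2 hsum).tsum_mul_left _
    _ = piSeries l β s d * (GLog l li β s - gLogPartialSum l li β s d) :=
        congrArg _ (eq_sub_of_add_eq' (hsum.sum_add_tsum_nat_add d))

end FunctionalEquations

section Membership

open PowerSeries

variable {Fq : Type*} [Field Fq] [Finite Fq] {l li : (CInf Fq)⟦X⟧} {β : CInf Fq}
  {M : Subfield (CInf Fq)⸨X⸩}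

theorem coe_carlitzFactor_mem (hθ : HahnSeries.C (theta Fq) ∈ M) (hl : (l : (CInf Fq)⸨X⸩) ∈ M)
    (i : ℕ) : (carlitzFactor l i : (CInf Fq)⸨X⸩) ∈ M := by
  rw [carlitzFactor, coe_sub, coe_one, coe_mul, coe_C, coe_pow]
  exact sub_mem (one_mem M) (mul_mem hθ (pow_mem hl _))

theorem coe_piSeries_mem (hθ : HahnSeries.C (theta Fq) ∈ M) (hl : (l : (CInf Fq)⸨X⸩) ∈ M)
    (hβ : HahnSeries.C β ∈ M) (s m : ℕ) : (piSeries l β s m : (CInf Fq)⸨X⸩) ∈ M := by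
  rw [piSeries_eq, coe_mul, coe_C, map_prod, map_pow, map_inv₀]
  refine mul_mem (pow_mem (inv_mem hβ) m) (prod_mem fun i _ => ?_)
  rw [coe_pow]
  exact pow_mem (coe_carlitzFactor_mem hθ hl _) s

theorem coe_gLogPartialSum_mem (hθ : HahnSeries.C (theta Fq) ∈ M) (hl : (l : (CInf Fq)⸨X⸩) ∈ M)
    (hl0 : constantCoeff l = 0) (hli : (li : (CInf Fq)⸨X⸩) ∈ M) (hβ : HahnSeries.C β ∈ M)
    (hβ0 : β ≠ 0) (s N : ℕ) : (gLogPartialSum l li β s N : (CInf Fq)⸨X⸩) ∈ M := by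
  rw [gLogPartialSum, map_sum]
  refine sum_mem fun m _ => ?_
  rw [coe_mul, coe_pow, coe_inv (constantCoeff_piSeries_ne_zero hl0 hβ0 s m)]
  exact mul_mem (pow_mem hli _) (inv_mem (coe_piSeries_mem hθ hl hβ s m))

open scoped PowerSeries.WithPiTopology

variable {F : Subfield (CInf Fq)}

theorem coe_GZero_mem_laurentSubfield (hθ : theta Fq ∈ F)
    (hl : (l : (CInf Fq)⸨X⸩) ∈ laurentSubfield F) (hl0 : constantCoeff l = 0) (s : ℕ) :
    (GZero l s : (CInf Fq)⸨X⸩) ∈ laurentSubfield F := by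
  refine coe_mem_laurentSubfield_of_tendsto (fun N => ?_) (fun N => ?_)
    (multipliable_carlitzFactor_inv_pow hl0 s 1).hasProd.tendsto_prod_nat
  · rw [map_prod]
    refine prod_mem fun m _ => ?_
    rw [coe_pow, coe_inv (constantCoeff_carlitzFactor_ne_zero hl0 _)]
    exact pow_mem (inv_mem (coe_carlitzFactor_mem (C_mem_laurentSubfield hθ) hl _)) s
  · rw [Finset.prod_range_succ, ← mul_sub_one]
    exact (X_pow_dvd_carlitzFactor_inv_pow_sub_one hl0 s 1 N).mul_left _

theorem coe_GLog_mem_laurentSubfield (hθ : theta Fq ∈ F)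
    (hl : (l : (CInf Fq)⸨X⸩) ∈ laurentSubfield F) (hl0 : constantCoeff l = 0)
    (hli : (li : (CInf Fq)⸨X⸩) ∈ laurentSubfield F) (hli0 : constantCoeff li = 0) (hβ : β ∈ F)
    (hβ0 : β ≠ 0) (s : ℕ) : (GLog l li β s : (CInf Fq)⸨X⸩) ∈ laurentSubfield F := by
  refine coe_mem_laurentSubfield_of_tendsto
    (coe_gLogPartialSum_mem (C_mem_laurentSubfield hθ) hl hl0 hli (C_mem_laurentSubfield hβ) hβ0 s)
    (fun N => ?_) (summable_gLog_term hli0 _).hasSum.tendsto_sum_nat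
  rw [gLogPartialSum, gLogPartialSum, Finset.sum_range_succ, add_sub_cancel_left]
  exact X_pow_dvd_gLog_term hli0 _ N

end Membership

/-! ### Constants -/

section Constants

variable {Fq : Type*} [Field Fq] [Finite Fq] {β c : CInf Fq}

theorem theta_mem_kBar : theta Fq ∈ kBar Fq :=
  (kBar Fq).algebraMap_mem ⟨theta Fq, IntermediateField.mem_adjoin_simple_self Fq _⟩

theorem mem_kBar_of_mem_FqBar (hc : c ∈ FqBar Fq) : c ∈ kBar Fq := by
  rw [mem_algebraicClosure_iff] at hc ⊢
  exact hc.tower_top _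

theorem mem_kBar_of_mem_FqBarThetaBeta (hβ : β ∈ kBar Fq) (hc : c ∈ FqBarThetaBeta Fq β) :
    c ∈ kBar Fq := by
  have hle : FqBarThetaBeta Fq β ≤
      (kBar Fq).toSubfield.toIntermediateField fun x => mem_kBar_of_mem_FqBar x.2 := by
    rw [IntermediateField.adjoin_le_iff]
    rintro x (rfl | rfl)
    exacts [theta_mem_kBar, hβ]
  exact hle hc

theorem mem_kBar_of_mem_B (hβ : β ∈ kBar Fq) (hc : c ∈ B Fq β) : c ∈ kBar Fq := by
  obtain ⟨n, y, hy⟩ := mem_perfectClosure_iff.1 hc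
  rw [mem_algebraicClosure_iff]
  refine IsAlgebraic.of_pow (n := ringExpChar (FqBarThetaBeta Fq β) ^ n)
    (pow_pos (expChar_pos (FqBarThetaBeta Fq β) _) n) ?_
  rw [← hy]
  exact mem_algebraicClosure_iff.1 (mem_kBar_of_mem_FqBarThetaBeta hβ y.2)

theorem mem_B_of_mem_FqBarThetaBeta (hc : c ∈ FqBarThetaBeta Fq β) : c ∈ B Fq β :=
  (B Fq β).algebraMap_mem ⟨c, hc⟩

theorem mem_B_of_mem_FqBar (hc : c ∈ FqBar Fq) : c ∈ B Fq β :=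
  mem_B_of_mem_FqBarThetaBeta ((FqBarThetaBeta Fq β).algebraMap_mem ⟨c, hc⟩)

theorem theta_mem_B (β : CInf Fq) : theta Fq ∈ B Fq β :=
  mem_B_of_mem_FqBarThetaBeta (IntermediateField.subset_adjoin _ _ (by simp))

theorem self_mem_B (β : CInf Fq) : β ∈ B Fq β :=
  mem_B_of_mem_FqBarThetaBeta (IntermediateField.subset_adjoin _ _ (by simp))

theorem mem_B_of_mem_k (hc : c ∈ k Fq) : c ∈ B Fq β := by
  have hle : k Fq ≤ (B Fq β).toSubfield.toIntermediateField
      fun x => mem_B_of_mem_FqBar ((FqBar Fq).algebraMap_mem x) := by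
    rw [IntermediateField.adjoin_simple_le_iff]
    exact theta_mem_B β
  exact hle hc

theorem mem_FqBar_of_pow_eq_self {d : ℕ} (hd : 1 ≤ d) (hc : c ^ (q Fq ^ d) = c) :
    c ∈ FqBar Fq := by
  rw [mem_algebraicClosure_iff]
  exact ⟨Polynomial.X ^ (q Fq ^ d) - Polynomial.X,
    FiniteField.X_pow_card_sub_X_ne_zero Fq (one_lt_q_pow hd), by simp [hc]⟩

theorem IsExpansion.coeff_mem_B {d : ℕ} (hd : 1 ≤ d) {u x : CInf Fq} {f : (CInf Fq)⟦X⟧}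
    (hf : IsExpansion d u f x) (j : ℕ) : PowerSeries.coeff j f ∈ B Fq β :=
  mem_B_of_mem_FqBar (mem_FqBar_of_pow_eq_self hd (hf.1 j))

theorem exists_coe_eq_of_mem_kBar (hc : c ∈ kBar Fq) :
    ∃ x : AlgebraicClosure (KInf Fq), (x : CInf Fq) = c := by
  let φ := algebraMap (AlgebraicClosure (KInf Fq)) (CInf Fq)
  have hle : k Fq ≤ φ.fieldRange.toIntermediateField fun x => ⟨algebraMap Fq _ x, rfl⟩ := by
    rw [IntermediateField.adjoin_simple_le_iff]
    exact ⟨_, rfl⟩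
  let lift : k Fq →+* AlgebraicClosure (KInf Fq) :=
    (φ.rangeRestrictFieldEquiv.symm : φ.fieldRange →+* _).comp
      (Subfield.inclusion (S := (k Fq).toSubfield) hle)
  have hlift : φ.comp lift = (RingHom.id (CInf Fq)).comp (algebraMap (k Fq) (CInf Fq)) := by
    ext1 x
    exact congrArg Subtype.val (φ.rangeRestrictFieldEquiv.apply_symm_apply ⟨x, hle x.2⟩)
  have halg : IsAlgebraic (AlgebraicClosure (KInf Fq)) c :=
    (mem_algebraicClosure_iff.1 hc).ringHom_of_comp_eq lift (RingHom.id _) lift.injective hlift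
  exact minpoly.mem_range_of_degree_eq_one _ _ (IsAlgClosed.degree_eq_one_of_irreducible _
    (minpoly.irreducible halg.isIntegral))

theorem exists_pow_eq_of_mem_B {p : ℕ} (hp : p.Prime) [CharP Fq p] (hβ : β ∈ kBar Fq)
    (hc : c ∈ B Fq β) : ∃ γ ∈ B Fq β, γ ^ p = c := by
  obtain ⟨x, rfl⟩ := exists_coe_eq_of_mem_kBar (mem_kBar_of_mem_B hβ hc)
  obtain ⟨y, rfl⟩ := IsAlgClosed.exists_pow_nat_eq x hp.pos
  have hy : ((y ^ p : AlgebraicClosure (KInf Fq)) : CInf Fq) = (y : CInf Fq) ^ p :=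
    map_pow (algebraMap _ (CInf Fq)) y p
  refine ⟨y, ?_, hy.symm⟩
  have := charP_of_injective_algebraMap (algebraMap Fq (FqBarThetaBeta Fq β)).injective p
  have : ExpChar (FqBarThetaBeta Fq β) p := ExpChar.prime hp
  rw [mem_perfectClosure_iff, ringExpChar.eq _ p] at hc ⊢
  obtain ⟨n, hn⟩ := hc
  refine ⟨n + 1, ?_⟩
  rwa [hy, ← pow_mul, ← pow_succ'] at hn

end Constants

/-! ### The difference field of algebraic Laurent series -/

section MahlerExtension

variable {Fq : Type*} [Field Fq] [Finite Fq] {β : CInf Fq} {x : (CInf Fq)⸨X⸩} {N : ℕ}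

theorem algebraMap_k_laurentSeries (c : k Fq) :
    algebraMap (k Fq) (CInf Fq)⸨X⸩ c = HahnSeries.C (c : CInf Fq) := by
  have h : algebraMap (CInf Fq) (CInf Fq)⸨X⸩ c = HahnSeries.C (c : CInf Fq) := by
    rw [HahnSeries.algebraMap_apply', PowerSeries.algebraMap_apply, HahnSeries.ofPowerSeries_C]
    rfl
  exact h

theorem algebraMap_k_mem_laurentSubfield (β : CInf Fq) (c : k Fq) :
    algebraMap (k Fq) (CInf Fq)⸨X⸩ c ∈ laurentSubfield (B Fq β).toSubfield := by
  rw [algebraMap_k_laurentSeries]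
  exact C_mem_laurentSubfield (mem_B_of_mem_k c.2)

theorem mem_laurentSubfield_of_mem_kZ (hx : x ∈ kZ Fq) :
    x ∈ laurentSubfield (B Fq β).toSubfield := by
  have hle : kZ Fq ≤ (laurentSubfield (B Fq β).toSubfield).toIntermediateField
      (algebraMap_k_mem_laurentSubfield β) := by
    rw [IntermediateField.adjoin_simple_le_iff]
    exact single_one_mem_laurentSubfield
  exact hle hx

/-- The field of Laurent series with coefficients in `𝐁` that are algebraic over `k(Z)`: the base
field of the functional equations of `G₀, …, Gₙ`. -/
noncomputable def algLaurent (β : CInf Fq) : IntermediateField (kZ Fq) (CInf Fq)⸨X⸩ :=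
  algebraicClosure (kZ Fq) (CInf Fq)⸨X⸩ ⊓
    (laurentSubfield (B Fq β).toSubfield).toIntermediateField
      fun x => mem_laurentSubfield_of_mem_kZ x.2

theorem mem_algLaurent_iff :
    x ∈ algLaurent β ↔ IsAlgebraic (kZ Fq) x ∧ x ∈ laurentSubfield (B Fq β).toSubfield := by
  rw [algLaurent, IntermediateField.mem_inf, mem_algebraicClosure_iff]
  rfl

instance : Algebra.IsAlgebraic (kZ Fq) (algLaurent β) :=
  ⟨fun x => (isAlgebraic_algHom_iff (algLaurent β).val (algLaurent β).val.injective).1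
    (mem_algLaurent_iff.1 x.2).1⟩

theorem isAlgebraic_C {c : CInf Fq} (hc : c ∈ kBar Fq) :
    IsAlgebraic (kZ Fq) (HahnSeries.C c : (CInf Fq)⸨X⸩) := by
  rw [mem_algebraicClosure_iff] at hc
  refine hc.ringHom_of_comp_eq (algebraMap (k Fq) (kZ Fq))
    (HahnSeries.C : CInf Fq →+* (CInf Fq)⸨X⸩) (algebraMap (k Fq) (kZ Fq)).injective ?_
  ext1 c
  exact algebraMap_k_laurentSeries c

theorem C_mem_algLaurent {c : CInf Fq} (hβ : β ∈ kBar Fq) (hc : c ∈ B Fq β) :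
    (HahnSeries.C c : (CInf Fq)⸨X⸩) ∈ algLaurent β :=
  mem_algLaurent_iff.2 ⟨isAlgebraic_C (mem_kBar_of_mem_B hβ hc), C_mem_laurentSubfield hc⟩

theorem mahler_mem_kZ (hN : N ≠ 0) (hx : x ∈ kZ Fq) : mahler (CInf Fq) N hN x ∈ kZ Fq := by
  let A : IntermediateField (k Fq) (CInf Fq)⸨X⸩ :=
    ((kZ Fq).toSubfield.comap (mahler (CInf Fq) N hN)).toIntermediateField fun c => by
      rw [Subfield.mem_comap, algebraMap_k_laurentSeries, mahler_C, ← algebraMap_k_laurentSeries]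
      exact (kZ Fq).algebraMap_mem c
  have hle : kZ Fq ≤ A := by
    rw [IntermediateField.adjoin_simple_le_iff]
    change mahler (CInf Fq) N hN (HahnSeries.single 1 1) ∈ kZ Fq
    rw [← PowerSeries.coe_X, mahler_coe, PowerSeries.expand_X, PowerSeries.coe_pow,
      PowerSeries.coe_X]
    exact pow_mem (IntermediateField.mem_adjoin_simple_self _ _) N
  exact hle hx

theorem mahler_mem_algLaurent (hN : N ≠ 0) (hx : x ∈ algLaurent β) :
    mahler (CInf Fq) N hN x ∈ algLaurent β := by
  rw [mem_algLaurent_iff] at hx ⊢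
  refine ⟨?_, mahler_mem_laurentSubfield hN hx.2⟩
  let f : kZ Fq →+* kZ Fq := ((mahler (CInf Fq) N hN).comp
    (algebraMap (kZ Fq) (CInf Fq)⸨X⸩)).codRestrict (kZ Fq) fun x => mahler_mem_kZ hN x.2
  exact hx.1.ringHom_of_comp_eq f (mahler (CInf Fq) N hN) f.injective rfl

/-- The difference extension given by the substitution `Z ↦ Z^N` on Laurent series, with
constants `𝐁` and with `𝐁((Z))` as the space of admissible solutions. -/
noncomputable def mahlerExtension {p : ℕ} (hp : p.Prime) [CharP Fq p] (hβ : β ∈ kBar Fq)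
    (hN : 1 < N) : DifferenceExtension (algLaurent β) (CInf Fq)⸨X⸩ p where
  σE := ((mahler (CInf Fq) N (by lia)).comp
    (algebraMap (algLaurent β) (CInf Fq)⸨X⸩)).codRestrict (algLaurent β)
      fun x => mahler_mem_algLaurent (by lia) x.2
  σ := mahler (CInf Fq) N (by lia)
  M := laurentSubfield (B Fq β).toSubfield
  const := (B Fq β).toSubfield.map HahnSeries.C
  map_algebraMap _ := rfl
  algebraMap_mem x := (mem_algLaurent_iff.1 x.2).2
  isAlgebraic := by
    rintro _ ⟨c, hc, rfl⟩
    exact isAlgebraic_algebraMap (⟨_, C_mem_algLaurent hβ hc⟩ : algLaurent β)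
  const_of_eigenvector := by
    rintro _ ⟨κ, -, rfl⟩ g hg h
    exact ⟨g.coeff 0, mem_laurentSubfield_iff.1 hg 0, (eq_C_of_mahler_eq _ hN h).symm⟩
  perfect := by
    rintro ⟨_, c, hc, rfl⟩
    obtain ⟨γ, hγ, rfl⟩ := exists_pow_eq_of_mem_B hp hβ hc
    exact ⟨⟨_, γ, hγ, rfl⟩, Subtype.ext (map_pow _ γ p).symm⟩

end MahlerExtension

/-! ### Linear relations -/

section LinearRelation

variable {Fq : Type*} [Field Fq] [Finite Fq] {n d : ℕ} {l : (CInf Fq)⟦X⟧}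
  {li : Fin n → (CInf Fq)⟦X⟧} {β : CInf Fq}

theorem charP_algLaurent (p : ℕ) [CharP Fq p] (β : CInf Fq) : CharP (algLaurent β) p := by
  have : CharP (CInf Fq) p := charP_of_injective_algebraMap (algebraMap Fq (CInf Fq)).injective p
  have : CharP (CInf Fq)⸨X⸩ p :=
    charP_of_injective_ringHom (HahnSeries.C : CInf Fq →+* (CInf Fq)⸨X⸩).injective p
  let incl := algebraMap (algLaurent β) (CInf Fq)⸨X⸩
  exact incl.charP incl.injective p

/-- The properties of the series `𝐥, 𝐥₁, …, 𝐥ₙ` from which the functional equations of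
`G₀, …, Gₙ` over `algLaurent β` follow. -/
structure IsInterpolationSeries (β : CInf Fq) (d : ℕ) (f : (CInf Fq)⟦X⟧) : Prop where
  coe_mem : (f : (CInf Fq)⸨X⸩) ∈ algLaurent β
  constantCoeff_eq_zero : PowerSeries.constantCoeff f = 0
  expand_eq_pow : PowerSeries.expand (q Fq ^ d) (q_pow_ne_zero d) f = f ^ (q Fq ^ d)

theorem IsExpansion.isInterpolationSeries (hd : 1 ≤ d) {u y : CInf Fq} (hu0 : u ≠ 0)
    (hu : ‖u‖ < 1) (huk : u ∈ kBar Fq) (hyk : y ∈ kBar Fq) (hy : ‖y‖ < 1)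
    {f : (CInf Fq)⟦X⟧} (hf : IsExpansion d u f y) : IsInterpolationSeries β d f where
  coe_mem := mem_algLaurent_iff.2 ⟨hf.isAlgebraic hd hu0 hu huk hyk,
    coe_mem_laurentSubfield_iff.2 (hf.coeff_mem_B hd)⟩
  constantCoeff_eq_zero := hf.constantCoeff_eq_zero hd hu hy
  expand_eq_pow := hf.expand_eq_pow

theorem mahler_GZero (hl : IsInterpolationSeries β d l) (hβ : β ≠ 0) (s : ℕ) :
    mahler (CInf Fq) (q Fq ^ d) (q_pow_ne_zero d) (GZero l s) =
      HahnSeries.C (β ^ d) * (piSeries l β s d : (CInf Fq)⸨X⸩) * (GZero l s : (CInf Fq)⸨X⸩) := by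
  rw [mahler_coe, expand_GZero hl.constantCoeff_eq_zero hl.expand_eq_pow hβ, PowerSeries.coe_mul,
    PowerSeries.coe_mul, PowerSeries.coe_C]

theorem mahler_GLog (hl : IsInterpolationSeries β d l) {f : (CInf Fq)⟦X⟧}
    (hf : IsInterpolationSeries β d f) (hβ : β ≠ 0) (s : ℕ) :
    mahler (CInf Fq) (q Fq ^ d) (q_pow_ne_zero d) (GLog l f β s) =
      (piSeries l β s d : (CInf Fq)⸨X⸩) * (GLog l f β s : (CInf Fq)⸨X⸩) +
        -((piSeries l β s d : (CInf Fq)⸨X⸩) * (gLogPartialSum l f β s d : (CInf Fq)⸨X⸩)) := by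
  rw [mahler_coe, expand_GLog hl.constantCoeff_eq_zero hl.expand_eq_pow hβ s
    hf.constantCoeff_eq_zero hf.expand_eq_pow, PowerSeries.coe_mul, PowerSeries.coe_sub, mul_sub,
    sub_eq_add_neg]

theorem exists_isSolution_mahlerExtension {p : ℕ} (hp : p.Prime) [CharP Fq p] (hd : 1 ≤ d)
    (hβ : β ∈ kBar Fq) (hβ0 : β ≠ 0) (s : ℕ) (hl : IsInterpolationSeries β d l)
    (hli : ∀ i, IsInterpolationSeries β d (li i)) :
    ∃ (κ a : algLaurent β) (b : Fin n → algLaurent β),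
      (mahlerExtension hp hβ (one_lt_q_pow (Fq := Fq) hd)).IsSolution
        (algebraMap (algLaurent β) (CInf Fq)⸨X⸩ κ) a b
        (GZero l s : (CInf Fq)⸨X⸩) fun i => (GLog l (li i) β s : (CInf Fq)⸨X⸩) := by
  have hl0 := hl.constantCoeff_eq_zero
  have hθE := C_mem_algLaurent hβ (theta_mem_B β)
  have hβE := C_mem_algLaurent hβ (self_mem_B β)
  have hκE := C_mem_algLaurent hβ (pow_mem (self_mem_B β) d)
  have hpiE : (piSeries l β s d : (CInf Fq)⸨X⸩) ∈ (algLaurent β).toSubfield :=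
    coe_piSeries_mem hθE hl.coe_mem hβE s d
  have hsumE (i : Fin n) :
      (gLogPartialSum l (li i) β s d : (CInf Fq)⸨X⸩) ∈ (algLaurent β).toSubfield :=
    coe_gLogPartialSum_mem hθE hl.coe_mem hl0 (hli i).coe_mem hβE hβ0 s d
  have hpi0 : (piSeries l β s d : (CInf Fq)⸨X⸩) ≠ 0 := by
    rw [map_ne_zero_iff _ HahnSeries.ofPowerSeries_injective]
    exact fun h => constantCoeff_piSeries_ne_zero hl0 hβ0 s d (by rw [h, map_zero])
  have hlM := (mem_algLaurent_iff.1 hl.coe_mem).2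
  exact ⟨⟨_, hκE⟩, ⟨_, hpiE⟩, fun i => ⟨_, neg_mem (mul_mem hpiE (hsumE i))⟩,
    { ratio_mem_const := ⟨β ^ d, pow_mem (self_mem_B β) d, rfl⟩
      ne_zero := fun h => hpi0 (congrArg Subtype.val h)
      zero_mem := coe_GZero_mem_laurentSubfield (theta_mem_B β) hlM hl0 s
      mem := fun i => coe_GLog_mem_laurentSubfield (theta_mem_B β) hlM hl0
        (mem_algLaurent_iff.1 (hli i).coe_mem).2 (hli i).constantCoeff_eq_zero (self_mem_B β) hβ0 s
      map_zero := mahler_GZero hl hβ0 s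
      map := fun i => mahler_GLog hl (hli i) hβ0 s }⟩

theorem exists_linear_relation_of_isInterpolationSeries (hd : 1 ≤ d) (hβ : β ∈ kBar Fq)
    (hβ0 : β ≠ 0) {s : ℕ} (hl : IsInterpolationSeries β d l)
    (hli : ∀ i, IsInterpolationSeries β d (li i))
    (hdep : ¬ AlgebraicIndependent (kZ Fq) (G l li β s)) :
    ∃ η : Fin (n + 1) → B Fq β, η ≠ 0 ∧
      IsAlgebraic (kZ Fq) (∑ i, HahnSeries.C (η i : CInf Fq) * G l li β s i) := by
  obtain ⟨p, -, hp, hchar, -⟩ := exists_q_eq_prime_pow Fq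
  have := Fact.mk hp
  have := charP_algLaurent p β
  obtain ⟨κ, a, b, hsol⟩ := exists_isSolution_mahlerExtension hp hd hβ hβ0 s hl hli
  obtain ⟨c, hc0, halg⟩ := hsol.exists_linear_relation fun h =>
    hdep (h.restrictScalars (algebraMap (kZ Fq) (algLaurent β)).injective)
  have hconst (i : Fin (n + 1)) :
      ∃ η : B Fq β, (HahnSeries.C (η : CInf Fq) : (CInf Fq)⸨X⸩) = c i :=
    let ⟨η, hη, h⟩ := (c i).2
    ⟨⟨η, hη⟩, h⟩
  choose η hη using hconst
  refine ⟨η, ?_, ?_⟩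
  · rintro rfl
    exact hc0 (funext fun i => Subtype.ext ((hη i).symm.trans (map_zero _)))
  · simp only [← hη] at halg
    exact halg.restrictScalars (kZ Fq)

end LinearRelation

theorem mainTheorem7_general {Fq : Type*} [Field Fq] [Finite Fq] {n d : ℕ} (hd : 1 ≤ d)
    {u : CInf Fq} (hu : u ∈ kBar Fq) (hu0 : u ≠ 0) (hu1 : ‖u‖ < 1)
    {l : (CInf Fq)⟦X⟧} {x : CInf Fq} (hx : x ∈ kBar Fq) (hx1 : ‖x‖ < 1)
    (hl : IsExpansion d u l x)
    {li : Fin n → (CInf Fq)⟦X⟧} {y : Fin n → CInf Fq} (hy : ∀ i, y i ∈ kBar Fq)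
    (hy1 : ∀ i, ‖y i‖ < 1) (hli : ∀ i, IsExpansion d u (li i) (y i))
    {β : CInf Fq} (hβ : β ∈ kBar Fq) (hβ0 : β ≠ 0) {s : ℕ}
    (hdep : ¬ AlgebraicIndependent (kZ Fq) (G l li β s)) :
    ∃ η : Fin (n + 1) → B Fq β, η ≠ 0 ∧
      IsAlgebraic (kZ Fq) (∑ i, HahnSeries.C (η i : CInf Fq) * G l li β s i) :=
  exists_linear_relation_of_isInterpolationSeries hd hβ hβ0
    (hl.isInterpolationSeries hd hu0 hu1 hu hx hx1)
    (fun i => (hli i).isInterpolationSeries hd hu0 hu1 hu (hy i) (hy1 i)) hdep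

section CarlitzPeriod

variable {Fq : Type*} [Field Fq] [Finite Fq] {θt : CInf Fq}

variable (Fq) in
theorem norm_one_div_theta_lt_one : ‖1 / theta Fq‖ < 1 := by
  rw [norm_div, norm_one, norm_theta]
  have hq : (1 : ℝ) < q Fq := mod_cast Finite.one_lt_card
  exact (div_lt_one (one_pos.trans hq)).2 hq

theorem norm_theta_mul (hθt : θt ^ (q Fq - 1) = -theta Fq) :
    ‖theta Fq * θt‖ = (q Fq : ℝ) ^ ((q Fq : ℝ) / ((q Fq : ℝ) - 1)) := by
  have hq : 1 < q Fq := Finite.one_lt_card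
  have hq' : (1 : ℝ) < q Fq := mod_cast hq
  have hnorm : ‖θt‖ = (q Fq : ℝ) ^ ((q Fq : ℝ) - 1)⁻¹ := by
    have hpow : ‖θt‖ ^ (q Fq - 1) = q Fq := by rw [← norm_pow, hθt, norm_neg, norm_theta]
    rw [← Nat.cast_pred (one_pos.trans hq), ← hpow,
      Real.pow_rpow_inv_natCast (norm_nonneg _) (Nat.sub_ne_zero_of_lt hq)]
  have hexp : (q Fq : ℝ) / (q Fq - 1) = 1 + ((q Fq : ℝ) - 1)⁻¹ := by
    field_simp [(sub_pos.2 hq').ne']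
    ring
  rw [norm_mul, norm_theta, hnorm, hexp, Real.rpow_add (one_pos.trans hq'), Real.rpow_one]

theorem norm_div_theta_mul_lt_one {w : CInf Fq} (hθt : θt ^ (q Fq - 1) = -theta Fq)
    (hw : ‖w‖ < (q Fq : ℝ) ^ ((q Fq : ℝ) / ((q Fq : ℝ) - 1))) :
    ‖w / (theta Fq * θt)‖ < 1 := by
  rw [norm_div, norm_theta_mul hθt]
  exact (div_lt_one ((norm_nonneg w).trans_lt hw)).2 hw

theorem mem_kBar_of_pow_eq (hθt : θt ^ (q Fq - 1) = -theta Fq) : θt ∈ kBar Fq := by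
  rw [mem_algebraicClosure_iff]
  refine IsAlgebraic.of_pow (Nat.sub_pos_of_lt (Finite.one_lt_card (α := Fq))) ?_
  rw [hθt]
  exact (mem_algebraicClosure_iff.1 theta_mem_kBar).neg

theorem K_le_kBar {n : ℕ} {w : Fin n → CInf Fq} (hθt : θt ∈ kBar Fq) (hw : ∀ i, w i ∈ kBar Fq) :
    K θt w ≤ kBar Fq := by
  rw [IntermediateField.adjoin_le_iff]
  rintro x (rfl | ⟨i, rfl⟩)
  exacts [hθt, hw i]

end CarlitzPeriod

end CarlitzMahler

open CarlitzMahler in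
theorem mainTheorem7 (Fq : Type*) [Field Fq] [Finite Fq] (n : ℕ)
    -- `θ̃` is a `(q-1)`-th root of `-θ`
    (θt : CInf Fq) (hθt : θt ^ (q Fq - 1) = -theta Fq)
    -- `u₁, …, uₙ ∈ k̄` with `v_∞(uᵢ) > -q/(q-1)`
    (w : Fin n → CInf Fq) (hw : ∀ i, w i ∈ kBar Fq)
    (hw' : ∀ i, ‖w i‖ < (q Fq : ℝ) ^ ((q Fq : ℝ) / ((q Fq : ℝ) - 1)))
    -- `u` is a uniformizer of `K = k(θ̃, u₁, …, uₙ)`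
    (u : CInf Fq) (hu : IsUniformizer (K θt w) u)
    -- `𝐥, 𝐥ᵢ ∈ 𝔽_{q^d}[[Z]]` with `𝐥(u) = 1/θ` and `𝐥ᵢ(u) = uᵢ/(θθ̃)`
    (d : ℕ) (hd : 1 ≤ d)
    (l : PowerSeries (CInf Fq)) (hl : IsExpansion d u l (1 / theta Fq))
    (li : Fin n → PowerSeries (CInf Fq))
    (hli : ∀ i, IsExpansion d u (li i) (w i / (theta Fq * θt)))
    (β : CInf Fq) (hβ : β ∈ kBar Fq) (hβ0 : β ≠ 0) (s : ℕ) (hs : 1 ≤ s)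
    (hdep : ¬ AlgebraicIndependent (kZ Fq) (G l li β s)) :
    ∃ η : Fin (n + 1) → B Fq β, η ≠ 0 ∧
      IsAlgebraic (kZ Fq) (∑ i, HahnSeries.C (η i : CInf Fq) * G l li β s i) := by
  have hθtk := mem_kBar_of_pow_eq hθt
  exact mainTheorem7_general hd (K_le_kBar hθtk hw hu.1) hu.2.1 hu.2.2.1
    (div_mem (one_mem _) theta_mem_kBar) (norm_one_div_theta_lt_one Fq) hl
    (fun i => div_mem (hw i) (mul_mem theta_mem_kBar hθtk))
    (fun i => norm_div_theta_mul_lt_one hθt (hw' i)) hli hβ hβ0 hdep
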